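/- Let $\mathcal{A}$ be a Frobenius algebra over $\mathbb{R}$: a finite-dimensional commutative associative unital real algebra with a linear form $\omega$ such that $\langle a,b\rangle=\omega(a\circ b)$ is nondegenerate. All functions below are smooth $\mathcal{A}$-valued functions of infinitely many real variables $t=(t_1,t_2,\dots)$, $t_1=x$, on a domain $\Omega$; here $\Omega$ meets every slice in which only finitely many of the $t_k$ vary in an open set, and smooth means $C^\infty$ in any finite set of the variables. Write $\partial=\partial/\partial x$ and $\partial_k=\partial/\partial t_k$; pseudo-differential operators $P=\sum_{i\le m}P_i\partial^i$ are composed by $\partial^i\circ f=\sum_{k\ge 0}\binom{i}{k}(\partial^k f)\,\partial^{i-k}$, and $P_+=\sum_{i\ge 0}P_i\partial^i$, $\mathrm{res}\,P=P_{-1}$. Let $L=\partial+U_1\partial^{-1}+U_2\partial^{-2}+\cdots$ be a solution of the $\mathcal{A}$-KP hierarchy $$\partial_r L=[(L^r)_+,L],\qquad r=1,2,\dots,$$ let $\Phi=\sum_{n\ge 0}W_n\partial^{-n}$, $W_0=1$, be a dressing operator of $L$, i.e. $L=\Phi\circ\partial\circ\Phi^{-1}$, and put $\widehat W(t,z)=\sum_{n\ge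 0}W_n(t)z^{-n}$. Let $\tau=\tau(t)$ be an $\mathcal{A}$-valued $\tau$-function, i.e. a smooth function with invertible values such that $$\widehat W(t,z)=G(z)[\tau](t)\circ\tau(t)^{-1},\qquad G(z)[f](t)=f\Big(t_1-\frac1z,\;t_2-\frac1{2z^2},\;t_3-\frac1{3z^3},\dots\Big),$$ as formal power series in $z^{-1}$, where $G(z)[f]$ is understood as its formal Taylor expansion in $z^{-1}$. Then for every integer $i\ge 1$ $$\mathrm{res}\,L^i=\frac{\partial}{\partial t_i}\big(\tau_x\circ\tau^{-1}\big).$$ -/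

import Mathlib

open scoped ContDiff

noncomputable section

namespace AKP

/-- A linear form `φ` on a commutative real algebra is a Frobenius (trace) form if the symmetric
bilinear form `⟨a, b⟩ = φ (a * b)` is nondegenerate. -/
def IsFrobeniusForm {A : Type*} [NormedCommRing A] [NormedAlgebra ℝ A]
    (φ : Module.Dual ℝ A) : Prop :=
  ((LinearMap.mul ℝ A).compr₂ φ).Nondegenerate

/-- Points `t = (t₁, t₂, …)`; the space variable is `x = t₁`. -/
abbrev Times : Type := ℕ+ → ℝ

/-- A domain for functions of infinitely many variables: its intersection with every slice, in
which only finitely many of the times vary, is open. (Open sets of `ℝ^ℕ`, the space of finitely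
supported sequences, open sets of weighted sequence spaces, etc.) -/
def IsTimeDomain (Ω : Set Times) : Prop :=
  ∀ (t : Times) (S : Finset ℕ+), IsOpen {y : S → ℝ | Function.updateFinset t S y ∈ Ω}

section Functions

variable {A : Type*} [NormedCommRing A] [NormedAlgebra ℝ A]

/-- `f` is smooth on `Ω`: it is `C^∞` in any finite set of the times, the others being fixed. -/
def SmoothOn (Ω : Set Times) (f : Times → A) : Prop :=
  ∀ (t : Times) (S : Finset ℕ+),
    ContDiffOn ℝ ∞ (fun y : S → ℝ => f (Function.updateFinset t S y))
      {y : S → ℝ | Function.updateFinset t S y ∈ Ω}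

/-- The partial derivative `∂f/∂t_k`. -/
def pderiv (k : ℕ+) (f : Times → A) : Times → A :=
  fun t => deriv (fun s : ℝ => f (Function.update t k s)) (t k)

/-- The coefficient of `z^{-n}` in `G(z)[f] = f (t₁ - 1/z, t₂ - 1/(2z²), t₃ - 1/(3z³), …)`, that
is the `n`-th Taylor coefficient at `u = 0` of `f (t₁ - u, t₂ - u²/2, …)`. The shifts of `t_k` with
`k > n` are of order higher than `n` in `u` and do not contribute. -/
def shiftCoeff (n : ℕ) (f : Times → A) : Times → A :=
  fun t => ((n.factorial : ℝ)⁻¹) •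
    iteratedDeriv n
      (fun u : ℝ => f (fun k : ℕ+ => if (k : ℕ) ≤ n then t k - u ^ (k : ℕ) / (k : ℕ) else t k)) 0

end Functions

/-- Pseudo-differential operators `∑_{i ≤ m} P_i ∂^i`, `∂ = ∂/∂x`, with `A`-valued coefficients. -/
structure PsiDO (A : Type*) [NormedCommRing A] [NormedAlgebra ℝ A] where
  coeff : ℤ → Times → A
  bounded : ∃ m : ℤ, ∀ i : ℤ, m < i → coeff i = 0

namespace PsiDO

variable {A : Type*} [NormedCommRing A] [NormedAlgebra ℝ A]

/-- Composition, from `∂^i ∘ f = ∑_{k ≥ 0} (i choose k) (∂^k f) ∂^{i-k}`: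
the coefficient of `∂^n` in `P ∘ Q` is `∑_{i, k} (i choose k) P_i (∂^k Q_{n-i+k})`
(a finite sum, as the orders are bounded above). -/
def comp (P Q : PsiDO A) : PsiDO A where
  coeff n t := ∑ᶠ p : ℤ × ℕ,
    (Ring.choose p.1 p.2 : ℤ) • (P.coeff p.1 t * (pderiv 1)^[p.2] (Q.coeff (n - p.1 + p.2)) t)
  bounded := by
    obtain ⟨m, hm⟩ := P.bounded
    obtain ⟨m', hm'⟩ := Q.bounded
    refine ⟨m + m', fun n hn => ?_⟩
    funext t
    have hz : ∀ k : ℕ, (pderiv 1)^[k] (0 : Times → A) = 0 := by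
      intro k
      induction k with
      | zero => rfl
      | succ k ih =>
        rw [Function.iterate_succ_apply', ih]
        funext s
        simp [pderiv]
    refine finsum_eq_zero_of_forall_eq_zero fun p => ?_
    by_cases h : m < p.1
    · simp [hm _ h]
    · rw [hm' (n - p.1 + p.2) (by omega), hz]
      simp

/-- The identity operator. -/
def one : PsiDO A where
  coeff i := if i = 0 then 1 else 0
  bounded := ⟨0, fun i hi => by simp [hi.ne']⟩

/-- The operator `∂`. -/
def D : PsiDO A where
  coeff i := if i = 1 then 1 else 0
  bounded := ⟨1, fun i hi => by simp [hi.ne']⟩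

/-- The power `P ∘ ⋯ ∘ P` with `r` factors. -/
def pow (P : PsiDO A) : ℕ → PsiDO A
  | 0 => one
  | r + 1 => (pow P r).comp P

/-- The pure differential part `P₊ = ∑_{i ≥ 0} P_i ∂^i`. -/
def plus (P : PsiDO A) : PsiDO A where
  coeff i := if 0 ≤ i then P.coeff i else 0
  bounded := by
    obtain ⟨m, hm⟩ := P.bounded
    exact ⟨m, fun i hi => by simp [hm i hi]⟩

/-- The residue, the coefficient of `∂^{-1}`. -/
def res (P : PsiDO A) : Times → A := P.coeff (-1)

/-- All coefficients are smooth on `Ω`. -/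
def Smooth (Ω : Set Times) (P : PsiDO A) : Prop := ∀ i : ℤ, SmoothOn Ω (P.coeff i)

/-- Equality of operators on `Ω`. -/
def EqOn (Ω : Set Times) (P Q : PsiDO A) : Prop := ∀ i : ℤ, Set.EqOn (P.coeff i) (Q.coeff i) Ω

end PsiDO

variable {A : Type*} [NormedCommRing A] [NormedAlgebra ℝ A]

/-- The Lax operator `L = ∂ + U₁ ∂^{-1} + U₂ ∂^{-2} + ⋯`. -/
def lax (U : ℕ+ → Times → A) : PsiDO A where
  coeff i := if i = 1 then 1 else if h : 0 < (-i).toNat then U ⟨(-i).toNat, h⟩ else 0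
  bounded := ⟨1, fun i hi => by
    have h1 : i ≠ 1 := hi.ne'
    have h2 : ¬ (0 < (-i).toNat) := by omega
    rw [if_neg h1, dif_neg h2]⟩

/-- The operator `Φ = W₀ + W₁ ∂^{-1} + W₂ ∂^{-2} + ⋯`. -/
def dressing (W : ℕ → Times → A) : PsiDO A where
  coeff i := if i ≤ 0 then W (-i).toNat else 0
  bounded := ⟨0, fun i hi => by simp [hi.not_ge]⟩

/-- `L` satisfies the `A`-KP hierarchy `∂L/∂t_r = [B_r, L]`, `B_r = (L^r)₊`, `r = 1, 2, …`,
on `Ω`. -/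
def IsKPSolution (Ω : Set Times) (L : PsiDO A) : Prop :=
  ∀ (r : ℕ+) (i : ℤ), ∀ t ∈ Ω,
    pderiv r (L.coeff i) t =
      ((L.pow r).plus.comp L).coeff i t - (L.comp (L.pow r).plus).coeff i t

/-- `Φ` dresses `L` on `Ω`: `L = Φ ∘ ∂ ∘ Φ⁻¹`. -/
def IsDressing (Ω : Set Times) (L Φ : PsiDO A) : Prop :=
  ∃ Ψ : PsiDO A, Ψ.Smooth Ω ∧
    PsiDO.EqOn Ω (Φ.comp Ψ) PsiDO.one ∧ PsiDO.EqOn Ω (Ψ.comp Φ) PsiDO.one ∧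
    PsiDO.EqOn Ω L ((Φ.comp PsiDO.D).comp Ψ)

/-- `τ` is a τ-function of `Φ = ∑ W_n ∂^{-n}`: it is smooth with invertible values, and
`∑ W_n(t) z^{-n} = G(z)[τ](t) τ(t)⁻¹` as formal power series in `z⁻¹`. -/
def IsTauFunction (Ω : Set Times) (W : ℕ → Times → A) (τ : Times → A) : Prop :=
  SmoothOn Ω τ ∧ (∀ t ∈ Ω, IsUnit (τ t)) ∧
    ∀ n : ℕ, ∀ t ∈ Ω, W n t = shiftCoeff n τ t * Ring.inverse (τ t)

end AKP

end

/-! Write `u = 1/z`, and `P(u) = ∑ P_{-n} u^n` for an operator of order at most 0; so `W(u) = Φ(u)`.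
The proof compares two expressions for `u W'(u)`.

The analytic one: `G(z)[τ]` satisfies `∂_u G = -∑_j u^j ∂_{j+1} G` (`shiftCoeff_succ`). Substituting
`G = W τ` and dividing by `τ` expresses `W'` through `∂_{j+1} W` and `θ_j = ∂_{j+1}τ / τ`. The
derivatives of `W` come from the Lax equations. A dressing operator need not satisfy the Sato
equations, but `∂_r Φ = Φ K_r - (L^r)₋ Φ` with `K_r` having `x`-independent coefficients
(`exists_const_sato`), and right composition with `K_r` multiplies symbols.

The algebraic one: with `T(u) = ∑_b u^b tail_b(u)`, `tail_b = (∂^b Φ⁻¹)₋ Φ`, one has `∑_j u^j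
((L^j)₋ Φ)(u) = W T + u W'` (`sum_minus_conj_pow_mul`).

Together they give `W (T - u (κ + θ)) = 0`, where `κ` collects the symbols of the `K_r`. As `W` has
constant term 1, `T = u (κ + θ)`. A telescoping sum shows that `∂_x` of the `i`-th coefficient of
`T` is `res L^i` (`derivation_tailSum`). Applying `∂_x` kills `κ`, so `res L^i = ∂_x (∂_i τ / τ)`,
which equals `∂_i (τ_x / τ)` because the derivatives commute.

This is carried out over an abstract commutative ring with commuting derivations (`PDO.res_pow_eq`),
then applied to the ring of smooth functions on `Ω`. -/

open Finset.HasAntidiagonal (antidiagonal mem_antidiagonal)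

/-! ### The ring of pseudo-differential operators over a differential ring. -/

namespace AKP

variable {R : Type*} [CommRing R]

/-- Families `(P_i)` indexed by `ℤ` that vanish for large `i`. -/
def boundedAbove (R : Type*) [CommRing R] : Submodule R (ℤ → R) where
  carrier := {P | ∃ m : ℤ, ∀ i, m < i → P i = 0}
  add_mem' := by
    rintro P Q ⟨m, hm⟩ ⟨m', hm'⟩
    refine ⟨max m m', fun i hi => ?_⟩
    simp [hm i (by omega), hm' i (by omega)]
  zero_mem' := ⟨0, fun _ _ => rfl⟩
  smul_mem' := by
    rintro c P ⟨m, hm⟩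
    exact ⟨m, fun i hi => by simp [hm i hi]⟩

/-- Pseudo-differential operators over the differential ring `(R, δ)`. -/
def PDO (_δ : Derivation ℤ R R) : Type _ := boundedAbove R

namespace PDO

variable {δ : Derivation ℤ R R}

noncomputable instance : AddCommGroup (PDO δ) := inferInstanceAs (AddCommGroup (boundedAbove R))

noncomputable instance : Module R (PDO δ) := inferInstanceAs (Module R (boundedAbove R))

/-- The coefficient of `∂^i`. -/
def coeff (P : PDO δ) (i : ℤ) : R := P.1 i

/-- The operator with given coefficients. -/
def ofCoeff (δ : Derivation ℤ R R) (p : ℤ → R) (m : ℤ) (h : ∀ i, m < i → p i = 0) : PDO δ :=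
  ⟨p, m, h⟩

@[ext] lemma ext {P Q : PDO δ} (h : ∀ i, P.coeff i = Q.coeff i) : P = Q :=
  Subtype.ext (funext h)

@[simp] lemma coeff_zero (i : ℤ) : (0 : PDO δ).coeff i = 0 := rfl
@[simp] lemma coeff_add (P Q : PDO δ) (i : ℤ) : (P + Q).coeff i = P.coeff i + Q.coeff i := rfl
@[simp] lemma coeff_sub (P Q : PDO δ) (i : ℤ) : (P - Q).coeff i = P.coeff i - Q.coeff i := rfl
@[simp] lemma coeff_smul (f : R) (P : PDO δ) (i : ℤ) : (f • P).coeff i = f * P.coeff i := rfl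

lemma coeff_sum {ι : Type*} (s : Finset ι) (P : ι → PDO δ) (i : ℤ) :
    (∑ j ∈ s, P j).coeff i = ∑ j ∈ s, (P j).coeff i := by
  classical
  induction s using Finset.induction_on with
  | empty => simp
  | insert a s ha ih => simp [Finset.sum_insert ha, ih]

/-- `P` has order at most `m`. -/
def OrderLE (P : PDO δ) (m : ℤ) : Prop := ∀ i, m < i → P.coeff i = 0

lemma exists_orderLE (P : PDO δ) : ∃ m, P.OrderLE m := P.2

/-- The coefficients of `∂^a ∘ P`. -/
noncomputable def leftCoeff (a : ℤ) (P : PDO δ) (n : ℤ) : R :=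
  ∑ᶠ k : ℕ, (Ring.choose a k : ℤ) • δ^[k] (P.coeff (n - a + k))

lemma leftCoeff_eq_sum {P : PDO δ} {m : ℤ} (hP : P.OrderLE m) (a n : ℤ) {K : ℕ}
    (hK : m + a - n < K) :
    leftCoeff a P n =
      ∑ k ∈ Finset.range K, (Ring.choose a k : ℤ) • δ^[k] (P.coeff (n - a + k)) := by
  refine finsum_eq_sum_of_support_subset _ fun k hk => ?_
  by_contra h
  simp only [Finset.coe_range, Set.mem_Iio, not_lt] at h
  refine hk ?_
  simp only
  rw [hP _ (by omega), iterate_map_zero, smul_zero]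

lemma leftCoeff_eq_zero {P : PDO δ} {m : ℤ} (hP : P.OrderLE m) (a n : ℤ) (h : m + a < n) :
    leftCoeff a P n = 0 := by
  rw [leftCoeff_eq_sum hP a n (K := 0) (by push_cast; omega)]
  simp

/-- The operator `∂^a ∘ P`. -/
noncomputable def left (a : ℤ) (P : PDO δ) : PDO δ :=
  ⟨leftCoeff a P, by
    obtain ⟨m, hm⟩ := P.exists_orderLE
    exact ⟨m + a, fun i hi => leftCoeff_eq_zero hm a i hi⟩⟩

lemma coeff_left (a : ℤ) (P : PDO δ) (n : ℤ) : (left a P).coeff n = leftCoeff a P n := rfl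

lemma OrderLE.left {P : PDO δ} {m : ℤ} (hP : P.OrderLE m) (a : ℤ) : (left a P).OrderLE (m + a) :=
  fun i hi => leftCoeff_eq_zero hP a i hi

lemma left_zero' (P : PDO δ) : left 0 P = P := by
  ext n
  obtain ⟨m, hm⟩ := P.exists_orderLE
  rw [coeff_left, leftCoeff_eq_sum hm 0 n (K := (m - n).toNat + 1) (by omega),
    Finset.sum_range_succ']
  simp [Ring.choose_zero_succ]

/-- Pascal's rule, valid for `Ring.choose` at negative `a` too; this is `∂^{a+1} = ∂ ∘ ∂^a` read on
coefficients. -/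
lemma coeff_left_succ (a : ℤ) (P : PDO δ) (n : ℤ) :
    (left (a + 1) P).coeff n = (left a P).coeff (n - 1) + δ ((left a P).coeff n) := by
  obtain ⟨m, hm⟩ := P.exists_orderLE
  simp only [coeff_left]
  obtain ⟨K, hK⟩ : ∃ K : ℕ, m + a - n < K := ⟨(m + a - n).toNat + 1, by omega⟩
  rw [leftCoeff_eq_sum hm (a + 1) n (K := K + 1) (by push_cast; omega),
    leftCoeff_eq_sum hm a (n - 1) (K := K + 1) (by push_cast; omega),
    leftCoeff_eq_sum hm a n hK, Finset.sum_range_succ', Finset.sum_range_succ',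
    map_sum]
  have h : ∀ k ∈ Finset.range K,
      (Ring.choose (a + 1) (k + 1) : ℤ) • δ^[k + 1] (P.coeff (n - (a + 1) + ((k + 1 : ℕ) : ℤ))) =
      (Ring.choose a (k + 1) : ℤ) • δ^[k + 1] (P.coeff (n - 1 - a + ((k + 1 : ℕ) : ℤ))) +
        δ ((Ring.choose a k : ℤ) • δ^[k] (P.coeff (n - a + k))) := by
    intro k _
    have e1 : n - (a + 1) + ((k + 1 : ℕ) : ℤ) = n - a + k := by push_cast; ring
    have e2 : n - 1 - a + ((k + 1 : ℕ) : ℤ) = n - a + k := by push_cast; ring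
    rw [Ring.choose_succ_succ, e1, e2, map_zsmul, ← Function.iterate_succ_apply' δ, add_smul,
      add_comm]
  rw [Finset.sum_congr rfl h, Finset.sum_add_distrib]
  have e3 : n - (a + 1) = n - 1 - a := by ring
  simp only [Ring.choose_zero_right, e3]
  ring

lemma left_add (a : ℤ) (P Q : PDO δ) : left a (P + Q) = left a P + left a Q := by
  ext n
  obtain ⟨m, hm⟩ := P.exists_orderLE
  obtain ⟨m', hm'⟩ := Q.exists_orderLE
  have h1 : P.OrderLE (max m m') := fun i hi => hm i (by omega)
  have h2 : Q.OrderLE (max m m') := fun i hi => hm' i (by omega)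
  have h3 : (P + Q).OrderLE (max m m') := fun i hi => by simp [h1 i hi, h2 i hi]
  have hK : max m m' + a - n < ((max m m' + a - n).toNat + 1 : ℕ) := by omega
  rw [coeff_add]
  simp only [coeff_left]
  rw [leftCoeff_eq_sum h1 a n hK, leftCoeff_eq_sum h2 a n hK, leftCoeff_eq_sum h3 a n hK,
    ← Finset.sum_add_distrib]
  simp [smul_add]

lemma coeff_left_one (P : PDO δ) (n : ℤ) :
    (left 1 P).coeff n = P.coeff (n - 1) + δ (P.coeff n) := by
  have := coeff_left_succ 0 P n
  rwa [zero_add, left_zero'] at this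

lemma left_one_left (a : ℤ) (P : PDO δ) : left 1 (left a P) = left (a + 1) P := by
  ext n
  rw [coeff_left_one, coeff_left_succ]

/-- If `∂ ∘ X = 0` then `X_{n-1} = -δ X_n`, so the vanishing of `X` in high orders propagates
downwards. -/
lemma left_one_injective : Function.Injective (left 1 : PDO δ → PDO δ) := by
  intro P Q h
  have key : ∀ n, P.coeff (n - 1) - Q.coeff (n - 1) = -δ (P.coeff n - Q.coeff n) := by
    intro n
    have := congrArg (fun X : PDO δ => X.coeff n) h
    simp only [coeff_left_one] at this
    rw [map_sub]
    linear_combination this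
  obtain ⟨m, hm⟩ := P.exists_orderLE
  obtain ⟨m', hm'⟩ := Q.exists_orderLE
  have h1 : ∀ j : ℕ, P.coeff (max m m' + 1 - j) - Q.coeff (max m m' + 1 - j) = 0 := by
    intro j
    induction j with
    | zero => simp [hm (max m m' + 1) (by omega), hm' (max m m' + 1) (by omega)]
    | succ j ih =>
      have := key (max m m' + 1 - j)
      rw [ih, map_zero, neg_zero] at this
      convert this using 3 <;> push_cast <;> ring
  ext n
  by_cases hn : max m m' < n
  · rw [hm n (by omega), hm' n (by omega)]
  · have := h1 (max m m' + 1 - n).toNat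
    rw [show max m m' + 1 - ((max m m' + 1 - n).toNat : ℤ) = n by omega] at this
    exact sub_eq_zero.mp this

/-- The coefficients of `P ∘ Q`. -/
noncomputable def mulCoeff (P Q : PDO δ) (n : ℤ) : R := ∑ᶠ i : ℤ, P.coeff i * (left i Q).coeff n

lemma mulCoeff_eq_sum {P Q : PDO δ} {m m' : ℤ} (hP : P.OrderLE m) (hQ : Q.OrderLE m') (n : ℤ)
    {a b : ℤ} (ha : a ≤ n - m') (hb : m ≤ b) :
    mulCoeff P Q n = ∑ i ∈ Finset.Icc a b, P.coeff i * (left i Q).coeff n := by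
  refine finsum_eq_sum_of_support_subset _ fun i hi => ?_
  by_contra h
  simp only [Finset.coe_Icc, Set.mem_Icc, not_and_or, not_le] at h
  refine hi ?_
  simp only
  rcases h with h | h
  · rw [hQ.left i n (by omega), mul_zero]
  · rw [hP i (by omega), zero_mul]

lemma mulCoeff_eq_zero {P Q : PDO δ} {m m' : ℤ} (hP : P.OrderLE m) (hQ : Q.OrderLE m') (n : ℤ)
    (h : m + m' < n) : mulCoeff P Q n = 0 := by
  rw [mulCoeff_eq_sum hP hQ n le_rfl le_rfl, Finset.Icc_eq_empty (by omega), Finset.sum_empty]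

noncomputable instance : Mul (PDO δ) where
  mul P Q := ⟨mulCoeff P Q, by
    obtain ⟨m, hm⟩ := P.exists_orderLE
    obtain ⟨m', hm'⟩ := Q.exists_orderLE
    exact ⟨m + m', fun i hi => mulCoeff_eq_zero hm hm' i hi⟩⟩

lemma coeff_mul (P Q : PDO δ) (n : ℤ) : (P * Q).coeff n = mulCoeff P Q n := rfl

lemma coeff_mul_eq_sum {P Q : PDO δ} {m m' : ℤ} (hP : P.OrderLE m) (hQ : Q.OrderLE m') (n : ℤ)
    {a b : ℤ} (ha : a ≤ n - m') (hb : m ≤ b) :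
    (P * Q).coeff n = ∑ i ∈ Finset.Icc a b, P.coeff i * (left i Q).coeff n :=
  mulCoeff_eq_sum hP hQ n ha hb

lemma OrderLE.mul {P Q : PDO δ} {m m' : ℤ} (hP : P.OrderLE m) (hQ : Q.OrderLE m') :
    (P * Q).OrderLE (m + m') := fun n hn => mulCoeff_eq_zero hP hQ n hn

lemma OrderLE.mono {P : PDO δ} {m m' : ℤ} (hP : P.OrderLE m) (h : m ≤ m') : P.OrderLE m' :=
  fun i hi => hP i (by omega)

lemma OrderLE.add {P Q : PDO δ} {m : ℤ} (hP : P.OrderLE m) (hQ : Q.OrderLE m) :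
    (P + Q).OrderLE m := fun i hi => by rw [coeff_add, hP i hi, hQ i hi, add_zero]

lemma left_one_mul (P Q : PDO δ) : left 1 (P * Q) = left 1 P * Q := by
  ext n
  obtain ⟨m, hm⟩ := P.exists_orderLE
  obtain ⟨m', hm'⟩ := Q.exists_orderLE
  rw [coeff_left_one, coeff_mul_eq_sum hm hm' (n - 1) (a := n - 1 - m') (b := m + 1) le_rfl
    (by omega), coeff_mul_eq_sum hm hm' n (a := n - 1 - m') (b := m + 1) (by omega) (by omega),
    coeff_mul_eq_sum (hm.left 1) hm' n (a := n - 1 - m') (b := m + 1) (by omega) le_rfl, map_sum]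
  simp only [Derivation.leibniz, smul_eq_mul, coeff_left_one, add_mul]
  have h1 : ∀ i, P.coeff (i - 1) * (left i Q).coeff n =
      P.coeff (i - 1) * (left (i - 1) Q).coeff (n - 1) +
        P.coeff (i - 1) * δ ((left (i - 1) Q).coeff n) := by
    intro i
    have := coeff_left_succ (i - 1) Q n
    rw [sub_add_cancel] at this
    rw [this, mul_add]
  simp only [h1, Finset.sum_add_distrib]
  -- The substitution `i ↦ i - 1` moves the summation window by one; only the two end terms change,
  -- and they vanish by the order bounds on `Q` and `P`.
  have shift : ∀ g : ℤ → R, g (n - 1 - m' - 1) = 0 → g (m + 1) = 0 →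
      ∑ i ∈ Finset.Icc (n - 1 - m') (m + 1), g (i - 1) =
      ∑ i ∈ Finset.Icc (n - 1 - m') (m + 1), g i := by
    intro g h0 h1
    have e1 : ∑ i ∈ Finset.Icc (n - 1 - m') (m + 1), g (i - 1) =
        ∑ i ∈ Finset.Icc (n - 1 - m' - 1) m, g i := by
      refine Finset.sum_nbij' (fun i => i - 1) (fun i => i + 1) ?_ ?_ ?_ ?_ ?_ <;>
        intros <;> simp_all
    rw [e1]
    have e2 : ∑ i ∈ Finset.Icc (n - 1 - m' - 1) m, g i =
        ∑ i ∈ Finset.Icc (n - 1 - m' - 1) (m + 1), g i := by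
      refine Finset.sum_subset (Finset.Icc_subset_Icc le_rfl (by omega)) fun i hi hi' => ?_
      simp only [Finset.mem_Icc] at hi hi'
      rw [show i = m + 1 by omega, h1]
    rw [e2]
    symm
    refine Finset.sum_subset (Finset.Icc_subset_Icc (by omega) le_rfl) fun i hi hi' => ?_
    simp only [Finset.mem_Icc] at hi hi'
    rw [show i = n - 1 - m' - 1 by omega, h0]
  rw [shift (fun i => P.coeff i * (left i Q).coeff (n - 1)), shift
    (fun i => P.coeff i * δ ((left i Q).coeff n))]
  · have : ∀ i, δ (P.coeff i) * (left i Q).coeff n = (left i Q).coeff n * δ (P.coeff i) :=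
      fun i => mul_comm _ _
    simp only [this]
    ring
  · rw [hm'.left _ n (by omega), map_zero, mul_zero]
  · rw [hm _ (by omega), zero_mul]
  · rw [hm'.left _ (n - 1) (by omega), mul_zero]
  · rw [hm _ (by omega), zero_mul]

/-- Negative powers are reached by cancelling `∂` on the left, so no binomial identity for the
infinite expansions is needed. Associativity then follows by exchanging two finite sums. -/
lemma left_mul (a : ℤ) (P Q : PDO δ) : left a (P * Q) = left a P * Q := by
  induction a using Int.induction_on with
  | zero => simp only [left_zero']
  | succ n ih => rw [← left_one_left, ih, left_one_mul, left_one_left]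
  | pred n ih =>
    apply left_one_injective
    rw [left_one_mul, left_one_left, left_one_left, sub_add_cancel, ih]

protected lemma mul_assoc (P Q S : PDO δ) : P * Q * S = P * (Q * S) := by
  ext n
  obtain ⟨m, hm⟩ := P.exists_orderLE
  obtain ⟨m', hm'⟩ := Q.exists_orderLE
  obtain ⟨l, hl⟩ := S.exists_orderLE
  rw [coeff_mul_eq_sum (hm.mul hm') hl n le_rfl le_rfl,
    coeff_mul_eq_sum hm (hm'.mul hl) n le_rfl le_rfl]
  have h1 : ∀ i ∈ Finset.Icc (n - l) (m + m'), (P * Q).coeff i * (left i S).coeff n =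
      ∑ a ∈ Finset.Icc (n - (m' + l)) m, P.coeff a * (left a Q).coeff i * (left i S).coeff n := by
    intro i hi
    rw [Finset.mem_Icc] at hi
    rw [coeff_mul_eq_sum hm hm' i (a := n - (m' + l)) (b := m) (by omega) le_rfl, Finset.sum_mul]
  have h2 : ∀ a ∈ Finset.Icc (n - (m' + l)) m, P.coeff a * (left a (Q * S)).coeff n =
      ∑ i ∈ Finset.Icc (n - l) (m + m'), P.coeff a * (left a Q).coeff i * (left i S).coeff n := by
    intro a ha
    rw [Finset.mem_Icc] at ha
    rw [left_mul, coeff_mul_eq_sum (hm'.left a) hl n (a := n - l) (b := m + m') le_rfl (by omega),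
      Finset.mul_sum]
    simp only [mul_assoc]
  rw [Finset.sum_congr rfl h1, Finset.sum_congr rfl h2, Finset.sum_comm]

/-- Multiplication by a function. -/
noncomputable def C (δ : Derivation ℤ R R) (f : R) : PDO δ :=
  ofCoeff δ (fun i => if i = 0 then f else 0) 0 fun i hi => by simp [hi.ne']

lemma coeff_C (f : R) (i : ℤ) : (C δ f).coeff i = if i = 0 then f else 0 := rfl

lemma C_orderLE (f : R) : (C δ f).OrderLE 0 := fun i hi => by simp [coeff_C, hi.ne']

lemma C_mul (f : R) (P : PDO δ) : C δ f * P = f • P := by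
  ext n
  obtain ⟨m, hm⟩ := P.exists_orderLE
  rw [coeff_mul_eq_sum (C_orderLE f) hm n (a := min 0 (n - m)) (b := 0) (by omega) le_rfl,
    Finset.sum_eq_single 0]
  · simp [coeff_C, left_zero']
  · intro b _ hb
    simp [coeff_C, hb]
  · intro h
    simp at h

noncomputable instance : One (PDO δ) := ⟨C δ 1⟩

lemma one_def : (1 : PDO δ) = C δ 1 := rfl

lemma coeff_one (i : ℤ) : (1 : PDO δ).coeff i = if i = 0 then 1 else 0 := rfl

lemma coeff_left_of_const {P : PDO δ} (hP : ∀ i, δ (P.coeff i) = 0) (a n : ℤ) :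
    (left a P).coeff n = P.coeff (n - a) := by
  obtain ⟨m, hm⟩ := P.exists_orderLE
  rw [coeff_left, leftCoeff_eq_sum hm a n (K := (m + a - n).toNat + 1) (by omega),
    Finset.sum_range_succ', Finset.sum_eq_zero]
  · simp
  · intro k _
    rw [Function.iterate_succ_apply, hP, iterate_map_zero, smul_zero]

protected lemma mul_one (P : PDO δ) : P * 1 = P := by
  ext n
  obtain ⟨m, hm⟩ := P.exists_orderLE
  have h1 : ∀ i, δ ((1 : PDO δ).coeff i) = 0 := by
    intro i
    rw [coeff_one]
    split_ifs <;> simp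
  rw [one_def, coeff_mul_eq_sum hm (C_orderLE (1 : R)) n (a := n) (b := max m n) (by omega) (by omega),
    Finset.sum_eq_single n]
  · rw [← one_def, coeff_left_of_const h1]
    simp [coeff_one]
  · intro b _ hb
    rw [← one_def, coeff_left_of_const h1, coeff_one, if_neg (by omega), mul_zero]
  · intro h
    simp at h

protected lemma mul_add (P Q S : PDO δ) : P * (Q + S) = P * Q + P * S := by
  ext n
  obtain ⟨m, hm⟩ := P.exists_orderLE
  obtain ⟨l, hl⟩ := Q.exists_orderLE
  obtain ⟨l', hl'⟩ := S.exists_orderLE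
  have h1 : Q.OrderLE (max l l') := hl.mono (le_max_left _ _)
  have h2 : S.OrderLE (max l l') := hl'.mono (le_max_right _ _)
  rw [coeff_add, coeff_mul_eq_sum hm h1 n le_rfl le_rfl, coeff_mul_eq_sum hm h2 n le_rfl le_rfl,
    coeff_mul_eq_sum hm (h1.add h2) n le_rfl le_rfl, ← Finset.sum_add_distrib]
  simp only [left_add, coeff_add, mul_add]

protected lemma add_mul (P Q S : PDO δ) : (P + Q) * S = P * S + Q * S := by
  ext n
  obtain ⟨m, hm⟩ := S.exists_orderLE
  obtain ⟨l, hl⟩ := P.exists_orderLE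
  obtain ⟨l', hl'⟩ := Q.exists_orderLE
  have h1 : P.OrderLE (max l l') := hl.mono (le_max_left _ _)
  have h2 : Q.OrderLE (max l l') := hl'.mono (le_max_right _ _)
  rw [coeff_add, coeff_mul_eq_sum h1 hm n le_rfl le_rfl, coeff_mul_eq_sum h2 hm n le_rfl le_rfl,
    coeff_mul_eq_sum (h1.add h2) hm n le_rfl le_rfl, ← Finset.sum_add_distrib]
  simp only [coeff_add, add_mul]

noncomputable instance : Ring (PDO δ) :=
  { (inferInstance : AddCommGroup (PDO δ)) with
    mul_assoc := PDO.mul_assoc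
    one_mul := fun P => by rw [one_def, C_mul, one_smul]
    mul_one := PDO.mul_one
    left_distrib := PDO.mul_add
    right_distrib := PDO.add_mul
    zero_mul := fun P => by
      have := PDO.add_mul 0 0 P
      rwa [add_zero, left_eq_add] at this
    mul_zero := fun P => by
      have := PDO.mul_add P 0 0
      rwa [add_zero, left_eq_add] at this }

instance : IsScalarTower R (PDO δ) (PDO δ) where
  smul_assoc f P Q := by
    rw [smul_eq_mul, smul_eq_mul, ← C_mul, ← C_mul, mul_assoc]

/-- The operator `∂`. -/
noncomputable def d (δ : Derivation ℤ R R) : PDO δ :=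
  ofCoeff δ (fun i => if i = 1 then 1 else 0) 1 fun i hi => by simp [hi.ne']

lemma coeff_d (i : ℤ) : (d δ).coeff i = if i = 1 then 1 else 0 := rfl

lemma d_orderLE : (d δ).OrderLE 1 := fun i hi => by simp [coeff_d, hi.ne']

lemma coeff_d_mul (P : PDO δ) (n : ℤ) : (d δ * P).coeff n = P.coeff (n - 1) + δ (P.coeff n) := by
  have h : d δ = left 1 1 := by
    ext i
    rw [coeff_left_one, coeff_one, coeff_one, coeff_d]
    have : δ (if i = 0 then (1 : R) else 0) = 0 := by split_ifs <;> simp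
    rw [this, add_zero]
    simp only [sub_eq_zero]
  rw [h, ← left_one_mul, one_mul, coeff_left_one]

/-- Composition with an operator whose coefficients are constants of `δ`. -/
lemma coeff_mul_of_const {P Q : PDO δ} {m m' : ℤ} (hP : P.OrderLE m) (hQ : Q.OrderLE m')
    (h : ∀ i, δ (Q.coeff i) = 0) (n : ℤ) {a b : ℤ} (ha : a ≤ n - m') (hb : m ≤ b) :
    (P * Q).coeff n = ∑ i ∈ Finset.Icc a b, P.coeff i * Q.coeff (n - i) := by
  rw [coeff_mul_eq_sum hP hQ n ha hb]
  simp only [coeff_left_of_const h]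

lemma coeff_mul_d (P : PDO δ) (n : ℤ) : (P * d δ).coeff n = P.coeff (n - 1) := by
  obtain ⟨m, hm⟩ := P.exists_orderLE
  have h1 : ∀ i, δ ((d δ).coeff i) = 0 := by
    intro i
    rw [coeff_d]
    split_ifs <;> simp
  rw [coeff_mul_of_const hm d_orderLE h1 n (a := n - 1) (b := max m (n - 1)) le_rfl (by omega),
    Finset.sum_eq_single (n - 1)]
  · simp [coeff_d]
  · intro b _ hb
    rw [coeff_d, if_neg (by omega), mul_zero]
  · intro h
    simp at h

lemma coeff_mul_d_pow (P : PDO δ) (j : ℕ) (n : ℤ) :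
    (P * d δ ^ j).coeff n = P.coeff (n - j) := by
  induction j generalizing n with
  | zero => simp
  | succ j ih =>
    rw [pow_succ, ← mul_assoc, coeff_mul_d, ih]
    congr 1
    push_cast
    ring

/-- The part of nonnegative order. -/
noncomputable def plus (P : PDO δ) : PDO δ :=
  ⟨fun i => if 0 ≤ i then P.coeff i else 0, by
    obtain ⟨m, hm⟩ := P.exists_orderLE
    exact ⟨m, fun i hi => by simp [hm i hi]⟩⟩

lemma coeff_plus (P : PDO δ) (i : ℤ) : P.plus.coeff i = if 0 ≤ i then P.coeff i else 0 := rfl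

/-- The part of negative order. -/
noncomputable def minus (P : PDO δ) : PDO δ :=
  ofCoeff δ (fun i => if i < 0 then P.coeff i else 0) (-1) fun i hi => by
    rw [if_neg (by omega)]

lemma coeff_minus (P : PDO δ) (i : ℤ) : P.minus.coeff i = if i < 0 then P.coeff i else 0 := rfl

lemma plus_add_minus (P : PDO δ) : P.plus + P.minus = P := by
  ext i
  rw [coeff_add, coeff_plus, coeff_minus]
  split_ifs <;> first | omega | simp

lemma minus_orderLE (P : PDO δ) : P.minus.OrderLE (-1) := fun i hi => by
  rw [coeff_minus, if_neg (by omega)]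

lemma minus_of_orderLE {P : PDO δ} (h : P.OrderLE (-1)) : P.minus = P := by
  ext i
  rw [coeff_minus]
  split_ifs with hi
  · rfl
  · rw [h i (by omega)]

lemma minus_add (P Q : PDO δ) : (P + Q).minus = P.minus + Q.minus := by
  ext i
  simp only [coeff_add, coeff_minus]
  split_ifs <;> simp

lemma minus_smul (f : R) (P : PDO δ) : (f • P).minus = f • P.minus := by
  ext i
  simp only [coeff_smul, coeff_minus]
  split_ifs <;> simp

lemma minus_sum {ι : Type*} (s : Finset ι) (P : ι → PDO δ) :
    (∑ j ∈ s, P j).minus = ∑ j ∈ s, (P j).minus := by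
  ext i
  simp only [coeff_sum, coeff_minus]
  split_ifs <;> simp

/-- A derivation acting on coefficients. -/
noncomputable def map (Δ : Derivation ℤ R R) (P : PDO δ) : PDO δ :=
  ⟨fun i => Δ (P.coeff i), by
    obtain ⟨m, hm⟩ := P.exists_orderLE
    exact ⟨m, fun i hi => by simp [hm i hi]⟩⟩

lemma coeff_map (Δ : Derivation ℤ R R) (P : PDO δ) (i : ℤ) :
    (P.map Δ).coeff i = Δ (P.coeff i) := rfl

lemma OrderLE.map {P : PDO δ} {m : ℤ} (hP : P.OrderLE m) (Δ : Derivation ℤ R R) :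
    (P.map Δ).OrderLE m := fun i hi => by rw [coeff_map, hP i hi, map_zero]

lemma left_map {Δ : Derivation ℤ R R} (hΔ : ∀ f, Δ (δ f) = δ (Δ f)) (a : ℤ) (P : PDO δ) :
    left a (P.map Δ) = (left a P).map Δ := by
  ext n
  obtain ⟨m, hm⟩ := P.exists_orderLE
  have hK : m + a - n < ((m + a - n).toNat + 1 : ℕ) := by omega
  rw [coeff_map, coeff_left, coeff_left, leftCoeff_eq_sum hm a n hK,
    leftCoeff_eq_sum (hm.map Δ) a n hK, map_sum]
  refine Finset.sum_congr rfl fun k _ => ?_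
  rw [map_zsmul, coeff_map]
  congr 1
  generalize P.coeff _ = f
  clear * - hΔ
  induction k with
  | zero => rfl
  | succ k ih => rw [Function.iterate_succ_apply', Function.iterate_succ_apply', ih, hΔ]

lemma map_mul {Δ : Derivation ℤ R R} (hΔ : ∀ f, Δ (δ f) = δ (Δ f)) (P Q : PDO δ) :
    (P * Q).map Δ = P.map Δ * Q + P * Q.map Δ := by
  ext n
  obtain ⟨m, hm⟩ := P.exists_orderLE
  obtain ⟨m', hm'⟩ := Q.exists_orderLE
  rw [coeff_map, coeff_add, coeff_mul_eq_sum hm hm' n le_rfl le_rfl,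
    coeff_mul_eq_sum (hm.map Δ) hm' n le_rfl le_rfl,
    coeff_mul_eq_sum hm (hm'.map Δ) n le_rfl le_rfl, map_sum, ← Finset.sum_add_distrib]
  refine Finset.sum_congr rfl fun i _ => ?_
  rw [Derivation.leibniz, left_map hΔ, coeff_map, coeff_map, smul_eq_mul, smul_eq_mul]
  ring

lemma map_self (P : PDO δ) : P.map δ = d δ * P - P * d δ := by
  ext n
  rw [coeff_map, coeff_sub, coeff_d_mul, coeff_mul_d]
  ring

end PDO

end AKP

/-! ### Dressing operators and the algebraic form of the residue formula. -/

namespace AKP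

lemma sum_antidiagonal_assoc {M : Type*} [AddCommMonoid M] (n : ℕ) (f : ℕ → ℕ → ℕ → M) :
    ∑ p ∈ antidiagonal n, ∑ q ∈ antidiagonal p.1, f q.1 q.2 p.2 =
      ∑ p ∈ antidiagonal n, ∑ q ∈ antidiagonal p.2, f p.1 q.1 q.2 := by
  rw [Finset.sum_sigma', Finset.sum_sigma']
  refine Finset.sum_nbij' (fun x => ⟨(x.2.1, x.2.2 + x.1.2), (x.2.2, x.1.2)⟩)
    (fun x => ⟨(x.1.1 + x.2.1, x.2.2), (x.1.1, x.2.1)⟩) ?_ ?_ ?_ ?_ ?_ <;>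
  · rintro ⟨⟨a, b⟩, ⟨c, e⟩⟩ h
    simp only [Finset.mem_sigma, mem_antidiagonal] at h
    obtain ⟨rfl, rfl⟩ := h
    simp [add_assoc]

namespace PDO

variable {R : Type*} [CommRing R]

section Dressing

variable {δ : Derivation ℤ R R}

lemma coeff_mul_top {P Q : PDO δ} {m m' : ℤ} (hP : P.OrderLE m) (hQ : Q.OrderLE m') :
    (P * Q).coeff (m + m') = P.coeff m * Q.coeff m' := by
  rw [coeff_mul_eq_sum hP hQ (m + m') (a := m) (b := m) (by omega) le_rfl, Finset.Icc_self,
    Finset.sum_singleton, coeff_left, leftCoeff_eq_sum hQ m (m + m') (K := 1) (by push_cast; omega)]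
  simp

/-- A left inverse of a monic operator of order zero has order zero. -/
lemma orderLE_zero_of_mul_eq_one {Φ Ψ : PDO δ} (hΦ : Φ.OrderLE 0) (h0 : Φ.coeff 0 = 1)
    (h : Ψ * Φ = 1) : Ψ.OrderLE 0 := by
  obtain ⟨m, hm⟩ := Ψ.exists_orderLE
  have hm' : Ψ.OrderLE (m.toNat : ℤ) := hm.mono (by omega)
  generalize m.toNat = k at hm'
  induction k with
  | zero => exact hm'
  | succ k ih =>
    refine ih fun i hi => ?_
    rcases eq_or_lt_of_le (show ((k + 1 : ℕ) : ℤ) ≤ i by push_cast; omega) with hik | hik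
    -- As `Φ` is monic, the top coefficient of `Ψ` is that of `Ψ Φ = 1`, which is zero in positive
    -- order.
    · have := coeff_mul_top hm' hΦ
      rw [h, h0, mul_one, coeff_one, add_zero, if_neg (by omega)] at this
      rw [← hik, this]
    · exact hm' i hik

lemma coeff_zero_of_mul_eq_one {Φ Ψ : PDO δ} (hΦ : Φ.OrderLE 0) (h0 : Φ.coeff 0 = 1)
    (h : Ψ * Φ = 1) : Ψ.coeff 0 = 1 := by
  have := coeff_mul_top (orderLE_zero_of_mul_eq_one hΦ h0 h) hΦ
  rw [h, h0, mul_one, coeff_one] at this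
  simpa using this.symm

/-- The operators `(∂^b Φ⁻¹)₋ Φ`. -/
noncomputable def tail (Φ Ψ : PDO δ) (b : ℕ) : PDO δ := (d δ ^ b * Ψ).minus * Φ

lemma tail_orderLE {Φ : PDO δ} (Ψ : PDO δ) (hΦ : Φ.OrderLE 0) (b : ℕ) :
    (tail Φ Ψ b).OrderLE (-1) := by
  simpa [tail] using (minus_orderLE (d δ ^ b * Ψ)).mul hΦ

/-- Left multiplication by `∂` lifts exactly the `∂^{-1}` term out of the negative part. -/
lemma d_mul_minus (X : PDO δ) : d δ * X.minus = (d δ * X).minus + C δ (X.coeff (-1)) := by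
  ext n
  rw [coeff_add, coeff_d_mul, coeff_minus, coeff_minus, coeff_minus, coeff_d_mul, coeff_C]
  rcases lt_trichotomy n 0 with hn | rfl | hn
  · rw [if_pos (by omega), if_pos hn, if_pos hn, if_neg (by omega), add_zero]
  · simp
  · rw [if_neg (by omega), if_neg (by omega), if_neg (by omega), if_neg (by omega), map_zero]

/-- Since `δ` acts on coefficients as the commutator with `∂`, and `∂ ∘` raises `b` up to a residue,
differentiation becomes a recursion in `b`. It drives the telescoping in `derivation_tailSum`. -/
lemma tail_map (Φ Ψ : PDO δ) (b : ℕ) :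
    (tail Φ Ψ b).map δ =
      tail Φ Ψ (b + 1) + (d δ ^ b * Ψ).coeff (-1) • Φ - tail Φ Ψ b * d δ := by
  rw [map_self, tail, tail, ← mul_assoc, d_mul_minus, add_mul, C_mul, ← mul_assoc, ← pow_succ']

lemma tail_zero {Φ Ψ : PDO δ} (hΦ : Φ.OrderLE 0) (h0 : Φ.coeff 0 = 1) (h : Ψ * Φ = 1) :
    tail Φ Ψ 0 = 1 - Φ := by
  have : Ψ.minus = Ψ - 1 := by
    ext i
    rw [coeff_minus, coeff_sub, coeff_one]
    rcases lt_trichotomy i 0 with hi | rfl | hi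
    · rw [if_pos hi, if_neg (by omega), sub_zero]
    · simp [coeff_zero_of_mul_eq_one hΦ h0 h]
    · rw [if_neg (by omega), if_neg (by omega), orderLE_zero_of_mul_eq_one hΦ h0 h i hi, sub_zero]
  rw [tail, pow_zero, one_mul, this, sub_mul, h, one_mul]

lemma dPow_coeff (b : ℕ) (i : ℤ) : (d δ ^ b).coeff i = if i = b then 1 else 0 := by
  have := coeff_mul_d_pow (1 : PDO δ) b i
  rw [one_mul, coeff_one] at this
  rw [this]
  simp only [sub_eq_zero]

lemma mul_dPow_eq {Φ : PDO δ} (hΦ : Φ.OrderLE 0) (j : ℕ) :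
    Φ * d δ ^ j = ∑ p ∈ antidiagonal j, Φ.coeff (-(p.1 : ℤ)) • d δ ^ p.2 +
      (Φ * d δ ^ j).minus := by
  ext n
  rw [coeff_add, coeff_sum, coeff_minus]
  simp only [coeff_smul, dPow_coeff, coeff_mul_d_pow]
  rcases lt_or_ge n 0 with hn | hn
  · rw [if_pos hn, Finset.sum_eq_zero, zero_add]
    intro p _
    rw [if_neg (by omega), mul_zero]
  · rw [if_neg (by omega), add_zero]
    rcases lt_or_ge (j : ℤ) n with hj | hj
    · rw [hΦ _ (by omega), Finset.sum_eq_zero]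
      intro p hp
      rw [mem_antidiagonal] at hp
      rw [if_neg (by omega), mul_zero]
    · rw [Finset.sum_eq_single (j - n.toNat, n.toNat)]
      · rw [if_pos (by simp [hn]), mul_one]
        congr 1
        simp only
        omega
      · intro p hp hne
        rw [mem_antidiagonal] at hp
        rw [if_neg, mul_zero]
        intro h
        exact hne (Prod.ext (by simp only; omega) (by simp only; omega))
      · intro h
        exact absurd (mem_antidiagonal.mpr (by simp only; omega)) h

lemma conj_pow_eq {Φ : PDO δ} (Ψ : PDO δ) (hΦ : Φ.OrderLE 0) (j : ℕ) :
    Φ * d δ ^ j * Ψ = ∑ p ∈ antidiagonal j, Φ.coeff (-(p.1 : ℤ)) • (d δ ^ p.2 * Ψ) +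
      (Φ * d δ ^ j).minus * Ψ := by
  conv_lhs => rw [mul_dPow_eq hΦ j]
  rw [add_mul, Finset.sum_mul]
  simp only [smul_mul_assoc]

/-- The remainder `(Φ ∂^j)₋ Ψ` has order at most -1, and since `Ψ` is monic its residue is that of
`Φ ∂^j`, namely `W_{j+1}`. -/
lemma res_conj_pow {Φ Ψ : PDO δ} (hΦ : Φ.OrderLE 0) (h0 : Φ.coeff 0 = 1) (h : Ψ * Φ = 1) (j : ℕ) :
    (Φ * d δ ^ j * Ψ).coeff (-1) = ∑ p ∈ antidiagonal j,
      Φ.coeff (-(p.1 : ℤ)) * (d δ ^ p.2 * Ψ).coeff (-1) + Φ.coeff (-(j + 1 : ℤ)) := by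
  rw [conj_pow_eq Ψ hΦ, coeff_add, coeff_sum]
  congr 1
  have := coeff_mul_top (minus_orderLE (Φ * d δ ^ j)) (orderLE_zero_of_mul_eq_one hΦ h0 h)
  rw [add_zero, coeff_zero_of_mul_eq_one hΦ h0 h, mul_one, coeff_minus, coeff_mul_d_pow,
    if_pos (by omega)] at this
  rw [this]
  congr 1
  ring

lemma minus_conj_pow_mul {Φ Ψ : PDO δ} (hΦ : Φ.OrderLE 0) (h0 : Φ.coeff 0 = 1) (h : Ψ * Φ = 1)
    (j : ℕ) :
    (Φ * d δ ^ j * Ψ).minus * Φ =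
      ∑ p ∈ antidiagonal j, Φ.coeff (-(p.1 : ℤ)) • tail Φ Ψ p.2 +
        (Φ * d δ ^ j).minus := by
  have h1 : ((Φ * d δ ^ j).minus * Ψ).OrderLE (-1) := by
    simpa using (minus_orderLE _).mul (orderLE_zero_of_mul_eq_one hΦ h0 h)
  rw [conj_pow_eq Ψ hΦ, minus_add, minus_sum, minus_of_orderLE h1, add_mul, Finset.sum_mul,
    mul_assoc _ Ψ, h, mul_one]
  simp only [minus_smul, smul_mul_assoc, tail]

/-- The coefficients of the generating series `∑_b u^b tail_b(u)`. -/
noncomputable def tailSum (Φ Ψ : PDO δ) (n : ℕ) : R :=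
  ∑ p ∈ antidiagonal n, (tail Φ Ψ p.1).coeff (-(p.2 : ℤ))

/-- In the sum of the recursions `tail_map`, the terms `tail_{p+1}` at `-q` and `tail_p ∂` at `-q`
cancel along the antidiagonal of `n + 1`, up to its two ends. What remains is the expansion
`res_conj_pow`. -/
lemma derivation_tailSum {Φ Ψ : PDO δ} (hΦ : Φ.OrderLE 0) (h0 : Φ.coeff 0 = 1) (h : Ψ * Φ = 1)
    (n : ℕ) : δ (tailSum Φ Ψ n) = (Φ * d δ ^ n * Ψ).coeff (-1) := by
  rw [tailSum, map_sum, res_conj_pow hΦ h0 h]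
  have h1 : ∀ p : ℕ × ℕ, δ ((tail Φ Ψ p.1).coeff (-(p.2 : ℤ))) =
      (tail Φ Ψ (p.1 + 1)).coeff (-(p.2 : ℤ)) - (tail Φ Ψ p.1).coeff (-((p.2 + 1 : ℕ) : ℤ)) +
        Φ.coeff (-(p.2 : ℤ)) * (d δ ^ p.1 * Ψ).coeff (-1) := by
    intro p
    rw [← coeff_map, tail_map, coeff_sub, coeff_add, coeff_mul_d, coeff_smul,
      show -((p.2 + 1 : ℕ) : ℤ) = -(p.2 : ℤ) - 1 by push_cast; ring]
    ring
  simp only [h1, Finset.sum_add_distrib, Finset.sum_sub_distrib]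
  have h2 := Finset.Nat.sum_antidiagonal_succ (n := n)
    (f := fun p => (tail Φ Ψ p.1).coeff (-(p.2 : ℤ)))
  have h3 := Finset.Nat.sum_antidiagonal_succ' (n := n)
    (f := fun p => (tail Φ Ψ p.1).coeff (-(p.2 : ℤ)))
  -- The two ends: one vanishes because tails have order at most -1, the other supplies `W_{n+1}`
  -- because `tail_0 = 1 - Φ`.
  have h4 : (tail Φ Ψ (n + 1)).coeff (-((0 : ℕ) : ℤ)) = 0 := tail_orderLE Ψ hΦ _ _ (by omega)
  have h5 : (tail Φ Ψ 0).coeff (-((n + 1 : ℕ) : ℤ)) = -Φ.coeff (-(n + 1 : ℤ)) := by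
    rw [tail_zero hΦ h0 h, coeff_sub, coeff_one, if_neg (by omega), zero_sub]
    push_cast
    rfl
  have h6 := Finset.Nat.sum_antidiagonal_swap (n := n)
    (f := fun p => Φ.coeff (-(p.1 : ℤ)) * (d δ ^ p.2 * Ψ).coeff (-1))
  simp only [Prod.fst_swap, Prod.snd_swap] at h6
  simp only [h4, h5] at h2 h3
  rw [h6]
  linear_combination h3 - h2

/-- The first sum is a convolution of symbols. The term `n W_n`, the coefficient of `u W'(u)`,
arises because `(Φ ∂^j)₋` contributes `W_n` for each of the `n` pairs `j + q = n` with `q ≥ 1`. -/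
lemma sum_minus_conj_pow_mul {Φ Ψ : PDO δ} (hΦ : Φ.OrderLE 0) (h0 : Φ.coeff 0 = 1)
    (h : Ψ * Φ = 1) (n : ℕ) :
    ∑ p ∈ antidiagonal n, ((Φ * d δ ^ p.1 * Ψ).minus * Φ).coeff (-(p.2 : ℤ)) =
      ∑ p ∈ antidiagonal n, Φ.coeff (-(p.1 : ℤ)) * tailSum Φ Ψ p.2 +
        n * Φ.coeff (-(n : ℤ)) := by
  simp only [minus_conj_pow_mul hΦ h0 h, coeff_add, coeff_sum, coeff_smul, Finset.sum_add_distrib]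
  congr 1
  · simp only [tailSum, Finset.mul_sum]
    exact sum_antidiagonal_assoc n fun a b c =>
      Φ.coeff (-(a : ℤ)) * (tail Φ Ψ b).coeff (-(c : ℤ))
  · cases n with
    | zero => simp [coeff_minus]
    | succ n =>
      rw [Finset.Nat.sum_antidiagonal_succ', Finset.sum_congr rfl
        (g := fun _ => Φ.coeff (-((n + 1 : ℕ) : ℤ)))]
      · simp [coeff_minus]
      · intro p hp
        rw [mem_antidiagonal] at hp
        rw [coeff_minus, if_pos (by push_cast; omega), coeff_mul_d_pow]
        congr 1
        push_cast
        omega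

/-- Dressing operators of a KP solution satisfy the Sato equations up to right composition with
operators whose coefficients are constants of `δ`. -/
lemma exists_const_sato {Δ : Derivation ℤ R R} (hΔ : ∀ f, Δ (δ f) = δ (Δ f)) {Φ Ψ L M : PDO δ}
    (hΦ : Φ.OrderLE 0) (h0 : Φ.coeff 0 = 1) (h : Ψ * Φ = 1) (h' : Φ * Ψ = 1)
    (hL : L = Φ * d δ * Ψ) (hM : M.OrderLE (-1)) (hLax : L.map Δ = L * M - M * L) :
    ∃ K : PDO δ, K.OrderLE (-1) ∧ (∀ i, δ (K.coeff i) = 0) ∧ Φ.map Δ = Φ * K - M * Φ := by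
  have hLΦ : L * Φ = Φ * d δ := by rw [hL, mul_assoc, h, mul_one]
  have hd : (d δ).map Δ = 0 := by
    ext i
    rw [coeff_map, coeff_d, coeff_zero]
    split_ifs <;> simp
  have h1 : L.map Δ * Φ + L * Φ.map Δ = Φ.map Δ * d δ := by
    rw [← map_mul hΔ, hLΦ, map_mul hΔ, hd, mul_zero, add_zero]
  -- The defect `Y` in the Sato equation satisfies `L Y = Y ∂`. Hence `Ψ Y` commutes with `∂`, which
  -- says that its coefficients are constants; it serves as `K`.
  set Y := Φ.map Δ + M * Φ with hY
  have hYord : Y.OrderLE (-1) := by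
    refine OrderLE.add (fun i hi => ?_) (by simpa using hM.mul hΦ)
    rw [coeff_map]
    rcases eq_or_lt_of_le (show 0 ≤ i by omega) with rfl | hi'
    · rw [h0, Derivation.map_one_eq_zero]
    · rw [hΦ i hi', map_zero]
  have hYK : Y = Φ * (Ψ * Y) := by rw [← mul_assoc, h', one_mul]
  have hcomm : L * Y = Y * d δ := by
    rw [hLax] at h1
    calc L * Y = L * Φ.map Δ + L * M * Φ := by rw [hY, mul_add, mul_assoc]
      _ = Φ.map Δ * d δ + M * (L * Φ) := by
        rw [← h1]
        noncomm_ring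
      _ = Y * d δ := by rw [hLΦ, hY, add_mul, mul_assoc]
  refine ⟨Ψ * Y, by simpa using (orderLE_zero_of_mul_eq_one hΦ h0 h).mul hYord, fun i => ?_, ?_⟩
  · rw [← coeff_map, map_self]
    have : d δ * (Ψ * Y) = Ψ * Y * d δ := by
      rw [mul_assoc Ψ, ← hcomm, hL]
      simp only [← mul_assoc, h, one_mul]
    rw [this, sub_self, coeff_zero]
  · rw [← hYK, hY, add_sub_cancel_right]

lemma conj_pow {Φ Ψ L : PDO δ} (h : Ψ * Φ = 1) (h' : Φ * Ψ = 1)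
    (hL : L = Φ * d δ * Ψ) (j : ℕ) : L ^ j = Φ * d δ ^ j * Ψ := by
  induction j with
  | zero => rw [pow_zero, pow_zero, mul_one, h']
  | succ j ih =>
    rw [pow_succ, ih, hL, pow_succ]
    calc Φ * d δ ^ j * Ψ * (Φ * d δ * Ψ) = Φ * d δ ^ j * (Ψ * Φ) * d δ * Ψ := by noncomm_ring
      _ = _ := by rw [h, mul_one, mul_assoc Φ]

end Dressing

/-- Let `L = Φ ∂ Φ⁻¹` solve the KP hierarchy for the commuting derivations `D 0 = ∂, D 1, …`, and
let `g_n` be the coefficients of the shifted τ-function, `g_n = W_n τ`. Then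
`res L^{r+1} = D_r (∂τ / τ)`. -/
theorem res_pow_eq (D : ℕ → Derivation ℤ R R) (hD : ∀ i j f, D i (D j f) = D j (D i f))
    {Φ Ψ L : PDO (D 0)} (hΦ : Φ.OrderLE 0) (h0 : Φ.coeff 0 = 1) (h : Ψ * Φ = 1) (h' : Φ * Ψ = 1)
    (hL : L = Φ * d (D 0) * Ψ)
    (hKP : ∀ r, L.map (D r) = (L ^ (r + 1)).plus * L - L * (L ^ (r + 1)).plus)
    {τ τ' : R} (hτ : τ * τ' = 1) (g : ℕ → R)
    (hg : ∀ n : ℕ, (n + 1 : R) * g (n + 1) = -∑ p ∈ antidiagonal n, D p.1 (g p.2))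
    (hW : ∀ n : ℕ, Φ.coeff (-(n : ℤ)) * τ = g n) (r : ℕ) :
    (L ^ (r + 1)).coeff (-1) = D r (D 0 τ * τ') := by
  have hpow := conj_pow h h' hL
  have hsato : ∀ r, ∃ K : PDO (D 0), K.OrderLE (-1) ∧ (∀ i, D 0 (K.coeff i) = 0) ∧
      Φ.map (D r) = Φ * K - (L ^ (r + 1)).minus * Φ := by
    intro r
    refine exists_const_sato (hD r 0) hΦ h0 h h' hL (minus_orderLE _) ?_
    have : (L ^ (r + 1)).plus = L ^ (r + 1) - (L ^ (r + 1)).minus :=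
      eq_sub_of_add_eq (plus_add_minus _)
    rw [hKP, this, sub_mul, mul_sub, ← pow_succ, ← pow_succ']
    abel
  choose K hK1 hK0 hK using hsato
  -- Generating series in `u`; `D n` stands for `∂/∂t_{n+1}`, which accounts for the factor `X` in
  -- front of `κ + θ` below.
  set W : PowerSeries R := PowerSeries.mk fun n => Φ.coeff (-(n : ℤ)) with hWdef
  set T : PowerSeries R := PowerSeries.mk (tailSum Φ Ψ) with hT
  set θ : PowerSeries R := PowerSeries.mk fun n => D n τ * τ' with hθ
  set κ : PowerSeries R := PowerSeries.mk fun n =>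
    ∑ p ∈ antidiagonal n, (K p.1).coeff (-(p.2 : ℤ)) with hκ
  have hWunit : IsUnit W := by
    rw [PowerSeries.isUnit_iff_constantCoeff]
    simp [hWdef, h0]
  have hdW : ∀ r a : ℕ, D r (Φ.coeff (-(a : ℤ))) =
      ∑ p ∈ antidiagonal a, Φ.coeff (-(p.1 : ℤ)) * (K r).coeff (-(p.2 : ℤ)) -
        ((Φ * d (D 0) ^ (r + 1) * Ψ).minus * Φ).coeff (-(a : ℤ)) := by
    intro r a
    rw [← coeff_map, hK, coeff_sub, hpow, coeff_mul_of_const hΦ (hK1 r) (hK0 r) _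
      (a := -(a : ℤ)) (b := 0) (by omega) le_rfl]
    congr 1
    refine Finset.sum_nbij' (fun i => ((-i).toNat, (a + i).toNat)) (fun p => -(p.1 : ℤ))
      ?_ ?_ ?_ ?_ ?_
    · intro i hi
      rw [Finset.mem_Icc] at hi
      rw [mem_antidiagonal]
      simp only
      omega
    · intro p hp
      rw [mem_antidiagonal] at hp
      rw [Finset.mem_Icc]
      omega
    · intro i hi
      rw [Finset.mem_Icc] at hi
      simp only
      omega
    · intro p hp
      rw [mem_antidiagonal] at hp
      exact Prod.ext (by simp only; omega) (by simp only; omega)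
    · intro i hi
      rw [Finset.mem_Icc] at hi
      congr 2 <;> omega
  -- The equation `hg` for `g = W τ`, expanded by Leibniz and divided by `τ`.
  have hrec : ∀ n : ℕ, (n + 1 : R) * Φ.coeff (-((n + 1 : ℕ) : ℤ)) =
      -∑ p ∈ antidiagonal n,
        (D p.1 (Φ.coeff (-(p.2 : ℤ))) + (D p.1 τ * τ') * Φ.coeff (-(p.2 : ℤ))) := by
    intro n
    have e1 := hg n
    simp only [← hW, Derivation.leibniz, smul_eq_mul] at e1
    have e2 := congrArg (· * τ') e1
    simp only [neg_mul, Finset.sum_mul] at e2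
    calc _ = (n + 1 : R) * (Φ.coeff (-((n + 1 : ℕ) : ℤ)) * τ) * τ' := by
          linear_combination (-(n + 1 : R) * Φ.coeff (-((n + 1 : ℕ) : ℤ))) * hτ
      _ = _ := by
          rw [e2]
          congr 1
          refine Finset.sum_congr rfl fun p _ => ?_
          linear_combination (D p.1 (Φ.coeff (-(p.2 : ℤ)))) * hτ
  -- Both expressions for `u W'` are equated: `hrec` with the derivatives of `W` replaced through
  -- `hdW`, and `sum_minus_conj_pow_mul`.
  have key : W * (T - PowerSeries.X * (κ + θ)) = 0 := by
    ext n
    rw [mul_sub, map_sub, map_zero, ← mul_assoc, mul_comm W PowerSeries.X, mul_assoc,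
      PowerSeries.coeff_mul]
    cases n with
    | zero =>
      rw [PowerSeries.coeff_zero_X_mul, sub_zero]
      simp [hT, hWdef, tailSum, tail_orderLE Ψ hΦ 0 0 (by norm_num)]
    | succ n =>
      have e1 := sum_minus_conj_pow_mul hΦ h0 h (n + 1)
      -- The power `L^0 = 1` has no negative part, so the sum over powers starts at `L^1`, matching
      -- the flows.
      have e2 : ((Φ * d (D 0) ^ 0 * Ψ).minus * Φ) = 0 := by
        rw [pow_zero, mul_one, h']
        have : (1 : PDO (D 0)).minus = 0 := by
          ext i
          rw [coeff_minus, coeff_one, coeff_zero]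
          split_ifs <;> first | omega | rfl
        rw [this, zero_mul]
      rw [Finset.Nat.sum_antidiagonal_succ, e2, coeff_zero, zero_add] at e1
      have e3 : ∑ p ∈ antidiagonal n, D p.1 (Φ.coeff (-(p.2 : ℤ))) =
          ∑ p ∈ antidiagonal n, Φ.coeff (-(p.1 : ℤ)) *
            (∑ q ∈ antidiagonal p.2, (K q.1).coeff (-(q.2 : ℤ))) -
          ∑ p ∈ antidiagonal n,
            ((Φ * d (D 0) ^ (p.1 + 1) * Ψ).minus * Φ).coeff (-(p.2 : ℤ)) := by
        simp only [hdW, Finset.sum_sub_distrib, Finset.mul_sum]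
        congr 1
        rw [← sum_antidiagonal_assoc n fun a b c => Φ.coeff (-(b : ℤ)) * (K a).coeff (-(c : ℤ)),
          ← sum_antidiagonal_assoc n fun a b c => Φ.coeff (-(a : ℤ)) * (K b).coeff (-(c : ℤ))]
        exact Finset.sum_congr rfl fun p _ => Finset.Nat.sum_antidiagonal_swap (n := p.1)
          (f := fun q => Φ.coeff (-(q.1 : ℤ)) * (K q.2).coeff (-(p.2 : ℤ)))
      have e4 := hrec n
      rw [Finset.sum_add_distrib, e3] at e4
      have e5 := Finset.Nat.sum_antidiagonal_swap (n := n)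
        (f := fun p => Φ.coeff (-(p.1 : ℤ)) * (D p.2 τ * τ'))
      simp only [Prod.fst_swap, Prod.snd_swap] at e5
      have e6 : ∑ p ∈ antidiagonal n, D p.1 τ * τ' * Φ.coeff (-(p.2 : ℤ)) =
          ∑ p ∈ antidiagonal n, Φ.coeff (-(p.1 : ℤ)) * (D p.2 τ * τ') := by
        rw [← e5]
        exact Finset.sum_congr rfl fun p _ => mul_comm _ _
      rw [e6] at e4
      rw [PowerSeries.coeff_succ_X_mul, mul_add, map_add, PowerSeries.coeff_mul,
        PowerSeries.coeff_mul]
      simp only [hWdef, hT, hκ, hθ, PowerSeries.coeff_mk]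
      push_cast at e1 e4 ⊢
      linear_combination (-1 : R) * e1 - e4
  have hTeq : T = PowerSeries.X * (κ + θ) :=
    sub_eq_zero.mp ((hWunit.mul_right_eq_zero).mp key)
  have hcoef : tailSum Φ Ψ (r + 1) =
      ∑ p ∈ antidiagonal r, (K p.1).coeff (-(p.2 : ℤ)) + D r τ * τ' := by
    have := congrArg (PowerSeries.coeff (r + 1)) hTeq
    rw [PowerSeries.coeff_succ_X_mul] at this
    simpa [hT, hκ, hθ] using this
  -- Applying `D 0` removes the constants `K`, that is, the freedom in the choice of dressing
  -- operator.
  rw [hpow, ← derivation_tailSum hΦ h0 h, hcoef, map_add, map_sum,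
    Finset.sum_eq_zero fun p _ => hK0 _ _, zero_add]
  have hinv : ∀ i, D i τ' = -(τ' * τ' * D i τ) := by
    intro i
    have := congrArg (D i) hτ
    rw [Derivation.leibniz, Derivation.map_one_eq_zero, smul_eq_mul, smul_eq_mul] at this
    linear_combination τ' * this - D i τ' * hτ
  simp only [Derivation.leibniz, smul_eq_mul, hinv, hD r 0]
  ring

end PDO

end AKP

/-! ### Calculus on finite-dimensional slices. -/

namespace AKP

open Function (updateFinset update)
open Filter Topology

variable {A : Type*} [NormedCommRing A] [NormedAlgebra ℝ A] {Ω : Set Times}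

lemma updateFinset_self (t : Times) (S : Finset ℕ+) :
    updateFinset t S (fun i : S => t i) = t :=
  Function.updateFinset_restrict t

lemma update_updateFinset_of_mem (t : Times) {S : Finset ℕ+} (y : S → ℝ) (k : S) (r : ℝ) :
    update (updateFinset t S y) k r = updateFinset t S (update y k r) := by
  funext i
  by_cases hi : i = k
  · subst hi
    simp [updateFinset]
  · rw [Function.update_of_ne hi]
    by_cases hS : i ∈ S
    · have : (⟨i, hS⟩ : S) ≠ k := fun h => hi (congrArg Subtype.val h)
      simp [updateFinset, hS, Function.update_of_ne this]
    · simp [updateFinset, hS]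

namespace SmoothOn

lemma congr {f g : Times → A} (hf : SmoothOn Ω f) (h : Set.EqOn g f Ω) : SmoothOn Ω g :=
  fun t S => (hf t S).congr fun _ hy => h hy

lemma const (c : A) : SmoothOn Ω fun _ => c := fun _ _ => contDiffOn_const

lemma add {f g : Times → A} (hf : SmoothOn Ω f) (hg : SmoothOn Ω g) :
    SmoothOn Ω fun t => f t + g t := fun t S => (hf t S).add (hg t S)

lemma mul {f g : Times → A} (hf : SmoothOn Ω f) (hg : SmoothOn Ω g) :
    SmoothOn Ω fun t => f t * g t := fun t S => (hf t S).mul (hg t S)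

lemma contDiffAt (hΩ : IsTimeDomain Ω) {f : Times → A} (hf : SmoothOn Ω f) {t : Times}
    {S : Finset ℕ+} {y : S → ℝ} (h : updateFinset t S y ∈ Ω) :
    ContDiffAt ℝ ∞ (fun y : S → ℝ => f (updateFinset t S y)) y :=
  (hf t S).contDiffAt ((hΩ t S).mem_nhds h)

lemma hasDerivAt_slice (hΩ : IsTimeDomain Ω) {f : Times → A} (hf : SmoothOn Ω f) {t : Times}
    {S : Finset ℕ+} {y : S → ℝ} (h : updateFinset t S y ∈ Ω) (k : S) :
    HasDerivAt (fun s : ℝ => f (update (updateFinset t S y) k s))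
      (fderiv ℝ (fun y : S → ℝ => f (updateFinset t S y)) y (Pi.single k 1)) (y k) := by
  have h1 := ((hf.contDiffAt hΩ h).differentiableAt (by simp)).hasFDerivAt
  have h2 := hasDerivAt_update y k (y k)
  simp only [update_updateFinset_of_mem]
  have h3 : update y k (y k) = y := Function.update_eq_self k y
  rw [← h3] at h1
  have h4 := h1.comp_hasDerivAt (y k) h2
  rw [h3] at h4
  exact h4

end SmoothOn

lemma updateFinset_apply_mem (t : Times) {S : Finset ℕ+} (y : S → ℝ) (k : S) :
    updateFinset t S y k = y k := by simp [updateFinset]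

lemma pderiv_eq_fderiv (hΩ : IsTimeDomain Ω) {f : Times → A} (hf : SmoothOn Ω f) {t : Times}
    {S : Finset ℕ+} {y : S → ℝ} (h : updateFinset t S y ∈ Ω) (k : S) :
    pderiv k f (updateFinset t S y) =
      fderiv ℝ (fun y : S → ℝ => f (updateFinset t S y)) y (Pi.single k 1) := by
  rw [pderiv, updateFinset_apply_mem]
  exact (hf.hasDerivAt_slice hΩ h k).deriv

lemma SmoothOn.hasDerivAt (hΩ : IsTimeDomain Ω) {f : Times → A} (hf : SmoothOn Ω f) {t : Times}
    (h : t ∈ Ω) (k : ℕ+) : HasDerivAt (fun s : ℝ => f (update t k s)) (pderiv k f t) (t k) := by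
  have h1 : updateFinset t {k} (fun i => t i) ∈ Ω := by rwa [updateFinset_self]
  have h2 := hf.hasDerivAt_slice hΩ h1 ⟨k, Finset.mem_singleton_self k⟩
  rw [← pderiv_eq_fderiv hΩ hf h1, updateFinset_self] at h2
  exact h2

lemma SmoothOn.pderiv (hΩ : IsTimeDomain Ω) {f : Times → A} (hf : SmoothOn Ω f) (k : ℕ+) :
    SmoothOn Ω (pderiv k f) := by
  intro t S
  -- The direction `k` may lie outside `S`. The slice is enlarged to `insert k S`, where `pderiv k
  -- f` is a component of the Fréchet derivative, and then pulled back along the affine embedding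
  -- `J`.
  let J : (S → ℝ) → (↥(insert k S) → ℝ) := fun y i => updateFinset t S y i
  have hJ : ContDiff ℝ ∞ J := by
    refine contDiff_pi.2 fun i => ?_
    by_cases hi : (i : ℕ+) ∈ S
    · simp only [J, updateFinset, hi, dif_pos]
      exact contDiff_apply ℝ ℝ _
    · simp only [J, updateFinset, hi]
      exact contDiff_const
  have hJt : ∀ y, updateFinset t (insert k S) (J y) = updateFinset t S y := by
    intro y
    funext i
    by_cases hi : i ∈ insert k S
    · rw [updateFinset_apply_mem t (J y) ⟨i, hi⟩]
    · have : i ∉ S := fun h => hi (Finset.mem_insert_of_mem h)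
      simp [updateFinset, hi, this]
  have h1 := (hf t (insert k S)).fderiv_of_isOpen (m := ∞) (hΩ t (insert k S)) (by simp)
  have h2 := h1.clm_apply (contDiffOn_const
    (c := (Pi.single ⟨k, Finset.mem_insert_self k S⟩ 1 : ↥(insert k S) → ℝ)))
  have h3 := h2.comp hJ.contDiffOn (s := {y : S → ℝ | updateFinset t S y ∈ Ω})
    (fun y hy => by
      change updateFinset t (insert k S) (J y) ∈ Ω
      rw [hJt]
      exact hy)
  refine h3.congr fun y hy => ?_
  have h4 : updateFinset t (insert k S) (J y) ∈ Ω := by rw [hJt]; exact hy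
  have := pderiv_eq_fderiv hΩ hf h4 ⟨k, Finset.mem_insert_self k S⟩
  rw [hJt] at this
  exact this

lemma pderiv_comm (hΩ : IsTimeDomain Ω) {f : Times → A} (hf : SmoothOn Ω f) (i j : ℕ+) {t : Times}
    (ht : t ∈ Ω) : pderiv i (pderiv j f) t = pderiv j (pderiv i f) t := by
  set S : Finset ℕ+ := {i, j} with hS
  set y : S → ℝ := fun i => t i with hy
  have hyt : updateFinset t S y = t := updateFinset_self t S
  have hmem : updateFinset t S y ∈ Ω := by rwa [hyt]
  set F : (S → ℝ) → A := fun y => f (updateFinset t S y) with hF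
  have hFs := hf.contDiffAt hΩ hmem
  have key : ∀ a b : S, pderiv a (pderiv b f) t =
      fderiv ℝ (fderiv ℝ F) y (Pi.single a 1) (Pi.single b 1) := by
    intro a b
    have h1 := pderiv_eq_fderiv hΩ (hf.pderiv hΩ b) hmem a
    have h2 : (fun y : S → ℝ => pderiv b f (updateFinset t S y)) =ᶠ[𝓝 y]
        fun y => fderiv ℝ F y (Pi.single b 1) := by
      filter_upwards [(hΩ t S).mem_nhds hmem] with z hz
      exact pderiv_eq_fderiv hΩ hf hz b
    have h3 : DifferentiableAt ℝ (fderiv ℝ F) y :=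
      (hFs.fderiv_right (m := ∞) (by simp)).differentiableAt (by simp)
    rw [h2.fderiv_eq, fderiv_clm_apply h3 (differentiableAt_const _), hyt] at h1
    simpa using h1
  have hsymm := hFs.isSymmSndFDerivAt (by
    rw [minSmoothness_of_isRCLikeNormedField]
    exact WithTop.coe_le_coe.2 (le_top : (2 : ℕ∞) ≤ ⊤))
  have h1 := key ⟨i, by simp [hS]⟩ ⟨j, by simp [hS]⟩
  have h2 := key ⟨j, by simp [hS]⟩ ⟨i, by simp [hS]⟩
  simp only at h1 h2
  rw [h1, h2]
  exact hsymm _ _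

lemma eventually_update_mem (hΩ : IsTimeDomain Ω) {t : Times} (ht : t ∈ Ω) (k : ℕ+) :
    ∀ᶠ s in 𝓝 (t k), update t k s ∈ Ω := by
  have h1 : ∀ s, update t k s = updateFinset t {k} (fun _ => s) := by
    intro s
    funext i
    by_cases hi : i = k
    · subst hi
      simp [updateFinset]
    · simp [updateFinset, hi]
  have hc : Continuous fun (s : ℝ) (_ : ({k} : Finset ℕ+)) => s := by fun_prop
  simp only [h1]
  refine hc.continuousAt.eventually ((hΩ t {k}).mem_nhds ?_)
  simp only [Set.mem_ofPred_eq, ← h1, Function.update_eq_self]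
  exact ht

lemma pderiv_congr (hΩ : IsTimeDomain Ω) {f g : Times → A} (h : Set.EqOn f g Ω) (k : ℕ+) :
    Set.EqOn (pderiv k f) (pderiv k g) Ω := by
  intro t ht
  refine Filter.EventuallyEq.deriv_eq ?_
  filter_upwards [eventually_update_mem hΩ ht k] with s hs
  exact h hs

lemma SmoothOn.ringInverse [CompleteSpace A] {f : Times → A} (hf : SmoothOn Ω f)
    (h : ∀ t ∈ Ω, IsUnit (f t)) : SmoothOn Ω fun t => Ring.inverse (f t) := by
  intro t S y hy
  obtain ⟨u, hu⟩ := h _ hy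
  have h1 := contDiffAt_ringInverse ℝ (n := ∞) u
  rw [hu] at h1
  exact h1.comp_contDiffWithinAt y (hf t S y hy)

/-! ### Taylor coefficients at the origin. -/

section TaylorCoefficients

/-- The `n`-th Taylor coefficient at the origin. -/
noncomputable def taylorCoeff (n : ℕ) (g : ℝ → A) : A :=
  ((n.factorial : ℝ)⁻¹) • iteratedDeriv n g 0

lemma taylorCoeff_succ (n : ℕ) (g : ℝ → A) :
    (n + 1 : ℝ) • taylorCoeff (n + 1) g = taylorCoeff n (deriv g) := by
  rw [taylorCoeff, taylorCoeff, smul_smul, iteratedDeriv_succ', Nat.factorial_succ]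
  congr 1
  have : (n.factorial : ℝ) ≠ 0 := by positivity
  have : (n + 1 : ℝ) ≠ 0 := by positivity
  push_cast
  field_simp

lemma taylorCoeff_congr (n : ℕ) {g h : ℝ → A} (hgh : g =ᶠ[𝓝 0] h) :
    taylorCoeff n g = taylorCoeff n h := by
  rw [taylorCoeff, taylorCoeff, hgh.iteratedDeriv_eq]

lemma taylorCoeff_neg (n : ℕ) (g : ℝ → A) :
    taylorCoeff n (fun u => -g u) = -taylorCoeff n g := by
  rw [taylorCoeff, taylorCoeff, iteratedDeriv_fun_neg, smul_neg]

lemma taylorCoeff_sum (n : ℕ) {ι : Type*} (s : Finset ι) (g : ι → ℝ → A)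
    (hg : ∀ i ∈ s, ContDiffAt ℝ ∞ (g i) 0) :
    taylorCoeff n (fun u => ∑ i ∈ s, g i u) = ∑ i ∈ s, taylorCoeff n (g i) := by
  classical
  induction s using Finset.induction_on with
  | empty => simp [taylorCoeff]
  | insert a s ha ih =>
    have h1 : ∀ i ∈ s, ContDiffAt ℝ ∞ (g i) 0 := fun i hi => hg i (Finset.mem_insert_of_mem hi)
    have h2 : ContDiffAt ℝ ∞ (fun u => ∑ i ∈ s, g i u) 0 := ContDiffAt.sum h1
    have h3 := hg a (Finset.mem_insert_self a s)
    simp only [Finset.sum_insert ha]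
    rw [← ih h1, taylorCoeff, taylorCoeff, taylorCoeff, ← smul_add,
      ← iteratedDeriv_fun_add (h3.of_le (by exact_mod_cast le_top))
        (h2.of_le (by exact_mod_cast le_top))]

lemma taylorCoeff_pow_smul (n k : ℕ) {g : ℝ → A} (hg : ContDiffAt ℝ ∞ g 0) :
    taylorCoeff n (fun u => u ^ k • g u) = if k ≤ n then taylorCoeff (n - k) g else 0 := by
  have h1 := iteratedDerivWithin_smul (n := n) (Set.mem_univ (0 : ℝ)) uniqueDiffOn_univ
    (f := fun u : ℝ => u ^ k) (g := g) (by fun_prop)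
    (hg.of_le (by exact_mod_cast le_top)).contDiffWithinAt
  simp only [iteratedDerivWithin_univ, iteratedDeriv_fun_pow_zero] at h1
  rw [taylorCoeff, show (fun u => u ^ k • g u) = (fun u : ℝ => u ^ k) • g from rfl, h1]
  split_ifs with hk
  · rw [Finset.sum_eq_single k]
    · rw [if_pos rfl, taylorCoeff, ← Nat.cast_smul_eq_nsmul ℝ, smul_smul, smul_smul]
      congr 1
      rw [Nat.cast_choose ℝ hk]
      have := (Nat.factorial_pos n).ne'
      have := (Nat.factorial_pos k).ne'
      have := (Nat.factorial_pos (n - k)).ne'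
      field_simp
    · intro b _ hb
      rw [if_neg hb, Nat.cast_zero, zero_smul, smul_zero]
    · intro h
      exact absurd (Finset.mem_range.mpr (by omega)) h
  · rw [Finset.sum_eq_zero, smul_zero]
    intro b hb
    rw [Finset.mem_range] at hb
    rw [if_neg (by omega), Nat.cast_zero, zero_smul, smul_zero]

end TaylorCoefficients

/-! ### The shift `G(z)` and its differential equation in `u = 1/z`. -/

section Shift

/-- The times `t₁ - u, t₂ - u²/2, …, t_N - u^N/N`, the others unchanged. -/
noncomputable def shift (N : ℕ) (t : Times) (u : ℝ) : Times :=
  fun k : ℕ+ => if (k : ℕ) ≤ N then t k - u ^ (k : ℕ) / (k : ℕ) else t k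

lemma shiftCoeff_eq (n : ℕ) (f : Times → A) (t : Times) :
    shiftCoeff n f t = taylorCoeff n fun u => f (shift n t u) := rfl

lemma shift_zero (N : ℕ) (t : Times) : shift N t 0 = t := by
  funext k
  simp [shift]

/-- The indices `1, …, N`. -/
def firstTimes (N : ℕ) : Finset ℕ+ := (Finset.range N).map ⟨Nat.succPNat, Nat.succPNat_injective⟩

lemma mem_firstTimes {N : ℕ} {k : ℕ+} : k ∈ firstTimes N ↔ (k : ℕ) ≤ N := by
  simp only [firstTimes, Finset.mem_map, Finset.mem_range, Function.Embedding.coeFn_mk]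
  constructor
  · rintro ⟨a, ha, rfl⟩
    simpa using ha
  · intro h
    have := k.pos
    exact ⟨(k : ℕ) - 1, by omega, by apply PNat.eq; simp; omega⟩

/-- The shift in the coordinates of the first `N` times. -/
noncomputable def shiftCurve (N : ℕ) (t : Times) (u : ℝ) : firstTimes N → ℝ :=
  fun k => t k - u ^ (k : ℕ) / (k : ℕ)

lemma shift_eq (N : ℕ) (t : Times) (u : ℝ) :
    shift N t u = updateFinset t (firstTimes N) (shiftCurve N t u) := by
  funext k
  by_cases hk : (k : ℕ) ≤ N
  · simp [shift, updateFinset, mem_firstTimes, hk, shiftCurve]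
  · simp [shift, updateFinset, mem_firstTimes, hk]

lemma contDiff_shiftCurve (N : ℕ) (t : Times) : ContDiff ℝ ∞ (shiftCurve N t) := by
  unfold shiftCurve
  fun_prop

lemma hasDerivAt_shiftCurve (N : ℕ) (t : Times) (u : ℝ) :
    HasDerivAt (shiftCurve N t) (fun k => -u ^ ((k : ℕ) - 1)) u := by
  rw [hasDerivAt_pi]
  intro k
  have h1 := ((hasDerivAt_pow (k : ℕ) u).div_const ((k : ℕ) : ℝ)).const_sub (t k)
  have h2 : ((k : ℕ) : ℝ) ≠ 0 := by exact_mod_cast (k : ℕ+).ne_zero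
  rwa [mul_div_cancel_left₀ _ h2] at h1

lemma eventually_shift_mem (hΩ : IsTimeDomain Ω) {t : Times} (ht : t ∈ Ω) (N : ℕ) :
    ∀ᶠ u in 𝓝 (0 : ℝ), shift N t u ∈ Ω := by
  simp only [shift_eq]
  refine (contDiff_shiftCurve N t).continuous.continuousAt.eventually
    ((hΩ t (firstTimes N)).mem_nhds ?_)
  simp only [Set.mem_ofPred_eq, ← shift_eq, shift_zero]
  exact ht

lemma SmoothOn.contDiffAt_shift (hΩ : IsTimeDomain Ω) {f : Times → A} (hf : SmoothOn Ω f)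
    {t : Times} (ht : t ∈ Ω) (N : ℕ) : ContDiffAt ℝ ∞ (fun u => f (shift N t u)) 0 := by
  simp only [shift_eq]
  have h1 : updateFinset t (firstTimes N) (shiftCurve N t 0) ∈ Ω := by
    rwa [← shift_eq, shift_zero]
  exact (hf.contDiffAt hΩ h1).comp (0 : ℝ) (contDiff_shiftCurve N t).contDiffAt

lemma deriv_comp_shift (hΩ : IsTimeDomain Ω) {f : Times → A} (hf : SmoothOn Ω f) {t : Times}
    {N : ℕ} {u : ℝ} (hu : shift N t u ∈ Ω) :
    deriv (fun u => f (shift N t u)) u =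
      -∑ j ∈ Finset.range N, u ^ j • pderiv j.succPNat f (shift N t u) := by
  simp only [shift_eq] at hu ⊢
  have h1 := ((hf.contDiffAt hΩ hu).differentiableAt (by simp)).hasFDerivAt
  have h2 := (h1.comp_hasDerivAt u (hasDerivAt_shiftCurve N t u)).deriv
  have h3 : (fun k : firstTimes N => -u ^ ((k : ℕ) - 1)) =
      -∑ k : firstTimes N, u ^ ((k : ℕ) - 1) • (Pi.single k 1 : firstTimes N → ℝ) := by
    funext i
    simp [Finset.sum_apply, Pi.single_apply]
  rw [h3, map_neg, map_sum] at h2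
  refine h2.trans (congrArg Neg.neg ?_)
  rw [Finset.sum_congr rfl fun k _ => by
    rw [map_smul, ← pderiv_eq_fderiv hΩ hf hu k]]
  rw [Finset.sum_coe_sort (firstTimes N) fun k : ℕ+ =>
    u ^ ((k : ℕ) - 1) • pderiv k f (updateFinset t (firstTimes N) (shiftCurve N t u))]
  generalize updateFinset t (firstTimes N) (shiftCurve N t u) = p
  rw [firstTimes, Finset.sum_map]
  simp

/-- The chain rule along the shift curve gives `∂_u = -∑_{j<N} u^j ∂_{j+1}`; in degree `n` only `j ≤
n` contribute, all present since `N > n`. -/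
lemma taylorCoeff_shift_succ (hΩ : IsTimeDomain Ω) {f : Times → A} (hf : SmoothOn Ω f)
    {t : Times} (ht : t ∈ Ω) {n N : ℕ} (hN : n + 1 ≤ N) :
    (n + 1 : ℝ) • taylorCoeff (n + 1) (fun u => f (shift N t u)) =
      -∑ p ∈ antidiagonal n,
        taylorCoeff p.2 fun u => pderiv p.1.succPNat f (shift N t u) := by
  have h0 : ∀ j : ℕ, ContDiffAt ℝ ∞ (fun u => pderiv j.succPNat f (shift N t u)) 0 :=
    fun j => (hf.pderiv hΩ _).contDiffAt_shift hΩ ht N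
  have h1 : deriv (fun u => f (shift N t u)) =ᶠ[𝓝 0]
      fun u => -∑ j ∈ Finset.range N, u ^ j • pderiv j.succPNat f (shift N t u) := by
    filter_upwards [eventually_shift_mem hΩ ht N] with u hu
    exact deriv_comp_shift hΩ hf hu
  rw [taylorCoeff_succ, taylorCoeff_congr n h1, taylorCoeff_neg, taylorCoeff_sum]
  · rw [Finset.sum_congr rfl fun j _ => taylorCoeff_pow_smul n j (h0 j), ← Finset.sum_filter,
      Finset.Nat.sum_antidiagonal_eq_sum_range_succ_mk]
    congr 1
    refine Finset.sum_congr ?_ fun _ _ => rfl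
    ext j
    simp only [Finset.mem_filter, Finset.mem_range]
    omega
  · intro j _
    exact ContDiffAt.smul (f := fun u : ℝ => u ^ j) (by fun_prop) (h0 j)

/-- The recursion for the Taylor coefficients does not involve `N`. This reconciles the truncations
in `shiftCoeff`, which vary with `n`. -/
lemma taylorCoeff_shift_eq (hΩ : IsTimeDomain Ω) {t : Times} (ht : t ∈ Ω) (n : ℕ) :
    ∀ {f : Times → A}, SmoothOn Ω f → ∀ {N : ℕ}, n ≤ N →
      taylorCoeff n (fun u => f (shift N t u)) = shiftCoeff n f t := by
  induction n using Nat.strong_induction_on with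
  | _ n ih =>
    intro f hf N hN
    rw [shiftCoeff_eq]
    cases n with
    | zero => simp [taylorCoeff, shift_zero]
    | succ n =>
      have h1 := taylorCoeff_shift_succ hΩ hf ht hN
      have h2 := taylorCoeff_shift_succ hΩ hf ht (le_refl (n + 1))
      have h3 : (n + 1 : ℝ) ≠ 0 := by positivity
      refine smul_right_injective A h3 ?_
      simp only
      rw [h1, h2]
      congr 1
      refine Finset.sum_congr rfl fun p hp => ?_
      rw [mem_antidiagonal] at hp
      rw [ih p.2 (by omega) (hf.pderiv hΩ _) (by omega),
        ih p.2 (by omega) (hf.pderiv hΩ _) (by omega)]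

lemma shiftCoeff_zero (f : Times → A) (t : Times) : shiftCoeff 0 f t = f t := by
  simp [shiftCoeff]

/-- The differential equation of `G(z)[f]` in `u = 1/z`. -/
lemma shiftCoeff_succ (hΩ : IsTimeDomain Ω) {f : Times → A} (hf : SmoothOn Ω f)
    {t : Times} (ht : t ∈ Ω) (n : ℕ) :
    (n + 1 : ℝ) • shiftCoeff (n + 1) f t =
      -∑ p ∈ antidiagonal n, shiftCoeff p.2 (pderiv p.1.succPNat f) t := by
  rw [shiftCoeff_eq, taylorCoeff_shift_succ hΩ hf ht le_rfl]
  congr 1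
  refine Finset.sum_congr rfl fun p hp => ?_
  rw [mem_antidiagonal] at hp
  exact taylorCoeff_shift_eq hΩ ht _ (hf.pderiv hΩ _) (by omega)

/-- The recursion writes each coefficient as a combination of lower ones applied to partial
derivatives, so smoothness in `t` follows by induction. -/
lemma SmoothOn.shiftCoeff (hΩ : IsTimeDomain Ω) (n : ℕ) :
    ∀ {f : Times → A}, SmoothOn Ω f → SmoothOn Ω (shiftCoeff n f) := by
  induction n using Nat.strong_induction_on with
  | _ n ih =>
    intro f hf
    cases n with
    | zero => exact hf.congr fun t _ => shiftCoeff_zero f t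
    | succ n =>
      have h1 : SmoothOn Ω fun t => ((n + 1 : ℝ)⁻¹) •
          -∑ p ∈ antidiagonal n, AKP.shiftCoeff p.2 (AKP.pderiv p.1.succPNat f) t := by
        intro t S
        refine ContDiffOn.const_smul _ (ContDiffOn.neg (ContDiffOn.sum fun p hp => ?_))
        rw [mem_antidiagonal] at hp
        exact ih p.2 (by omega) (hf.pderiv hΩ _) t S
      refine h1.congr fun t ht => ?_
      have h2 : (n + 1 : ℝ) ≠ 0 := by positivity
      simp only
      rw [← shiftCoeff_succ hΩ hf ht, inv_smul_smul₀ h2]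

lemma shiftCoeff_congr (hΩ : IsTimeDomain Ω) {f g : Times → A} (h : Set.EqOn f g Ω) (n : ℕ) :
    Set.EqOn (shiftCoeff n f) (shiftCoeff n g) Ω := by
  intro t ht
  refine taylorCoeff_congr n ?_
  filter_upwards [eventually_shift_mem hΩ ht n] with u hu
  exact h hu

end Shift

end AKP

/-! ### Smooth functions on `Ω` as a ring with commuting derivations. -/

namespace AKP

variable {A : Type*} [NormedCommRing A] [NormedAlgebra ℝ A] {Ω : Set Times}

/-- The smooth functions on `Ω`, as a subring of all functions on `Ω`. -/
def smoothSubring (Ω : Set Times) (A : Type*) [NormedCommRing A] [NormedAlgebra ℝ A] :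
    Subring (Ω → A) where
  -- The values outside `Ω` are immaterial, since `SmoothOn` examines a function only at points of
  -- `Ω`.
  carrier := {f | SmoothOn Ω (Function.extend Subtype.val f 0)}
  mul_mem' := fun hf hg => (SmoothOn.mul hf hg).congr fun t ht => by
    lift t to Ω using ht
    simp
  add_mem' := fun hf hg => (SmoothOn.add hf hg).congr fun t ht => by
    lift t to Ω using ht
    simp
  one_mem' := (SmoothOn.const (1 : A)).congr fun t ht => by
    lift t to Ω using ht
    simp
  zero_mem' := (SmoothOn.const (0 : A)).congr fun t ht => by
    lift t to Ω using ht
    simp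
  neg_mem' := fun hf => (SmoothOn.mul (SmoothOn.const (-1 : A)) hf).congr fun t ht => by
    lift t to Ω using ht
    simp

/-- The ring of smooth functions on `Ω`. -/
def SmoothFunctions (Ω : Set Times) (A : Type*) [NormedCommRing A] [NormedAlgebra ℝ A] : Type _ :=
  smoothSubring Ω A

namespace SmoothFunctions

noncomputable instance : CommRing (SmoothFunctions Ω A) :=
  inferInstanceAs (CommRing (smoothSubring Ω A))

@[ext] lemma ext {f g : SmoothFunctions Ω A} (h : ∀ t : Ω, f.1 t = g.1 t) : f = g :=
  Subtype.ext (funext h)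

@[simp] lemma val_zero (t : Ω) : (0 : SmoothFunctions Ω A).1 t = 0 := rfl

@[simp] lemma val_one (t : Ω) : (1 : SmoothFunctions Ω A).1 t = 1 := rfl

/-- Extension by zero. -/
noncomputable def extend (f : SmoothFunctions Ω A) : Times → A :=
  Function.extend Subtype.val f.1 0

lemma extend_apply (f : SmoothFunctions Ω A) (t : Ω) : f.extend t = f.1 t :=
  Subtype.val_injective.extend_apply _ _ _

lemma smooth_extend (f : SmoothFunctions Ω A) : SmoothOn Ω f.extend := f.2

/-- Restriction to `Ω`. -/
def restrict (f : Times → A) (hf : SmoothOn Ω f) : SmoothFunctions Ω A :=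
  ⟨fun t => f t, hf.congr fun t ht => by
    lift t to Ω using ht
    simp⟩

lemma restrict_apply (f : Times → A) (hf : SmoothOn Ω f) (t : Ω) : (restrict f hf).1 t = f t := rfl

lemma extend_eqOn {f : SmoothFunctions Ω A} {g : Times → A} (h : ∀ t : Ω, f.1 t = g t) :
    Set.EqOn f.extend g Ω := fun t ht => by
  rw [← h ⟨t, ht⟩, ← extend_apply]

/-- The partial derivatives as derivations. -/
noncomputable def partialDeriv (A : Type*) [NormedCommRing A] [NormedAlgebra ℝ A]
    (hΩ : IsTimeDomain Ω) (k : ℕ+) :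
    Derivation ℤ (SmoothFunctions Ω A) (SmoothFunctions Ω A) :=
  Derivation.mk' (AddMonoidHom.toIntLinearMap (AddMonoidHom.mk'
    (fun f => restrict (pderiv k f.extend) (f.smooth_extend.pderiv hΩ k)) fun f g => by
      ext t
      have h1 := (f.smooth_extend.hasDerivAt hΩ t.2 k).add (g.smooth_extend.hasDerivAt hΩ t.2 k)
      have h2 : Set.EqOn (f + g).extend (fun s => f.extend s + g.extend s) Ω :=
        extend_eqOn fun s => by rw [extend_apply, extend_apply]; rfl
      change pderiv k (f + g).extend t = pderiv k f.extend t + pderiv k g.extend t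
      rw [pderiv_congr hΩ h2 k t.2]
      exact h1.deriv)) fun f g => by
    ext t
    have h1 := (f.smooth_extend.hasDerivAt hΩ t.2 k).mul (g.smooth_extend.hasDerivAt hΩ t.2 k)
    have h2 : Set.EqOn (f * g).extend (fun s => f.extend s * g.extend s) Ω :=
      extend_eqOn fun s => by rw [extend_apply, extend_apply]; rfl
    change pderiv k (f * g).extend t =
      f.1 t * pderiv k g.extend t + g.1 t * pderiv k f.extend t
    rw [pderiv_congr hΩ h2 k t.2]
    refine h1.deriv.trans ?_
    rw [Function.update_eq_self, extend_apply, extend_apply]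
    ring

lemma partialDeriv_apply (hΩ : IsTimeDomain Ω) (k : ℕ+) {f : SmoothFunctions Ω A} {g : Times → A}
    (h : ∀ t : Ω, f.1 t = g t) (t : Ω) : (partialDeriv A hΩ k f).1 t = pderiv k g t :=
  pderiv_congr hΩ (extend_eqOn h) k t.2

lemma partialDeriv_comm (hΩ : IsTimeDomain Ω) (i j : ℕ+) (f : SmoothFunctions Ω A) :
    partialDeriv A hΩ i (partialDeriv A hΩ j f) = partialDeriv A hΩ j (partialDeriv A hΩ i f) := by
  ext t
  have h : ∀ k, ∀ s : Ω, (partialDeriv A hΩ k f).1 s = pderiv k f.extend s := fun k =>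
    partialDeriv_apply hΩ k fun s => (f.extend_apply s).symm
  rw [partialDeriv_apply hΩ i (h j), partialDeriv_apply hΩ j (h i)]
  exact pderiv_comm hΩ f.smooth_extend i j t.2

lemma iterate_partialDeriv_apply (hΩ : IsTimeDomain Ω) (k : ℕ+) {f : SmoothFunctions Ω A}
    {g : Times → A} (h : ∀ t : Ω, f.1 t = g t) (m : ℕ) (t : Ω) :
    ((partialDeriv A hΩ k)^[m] f).1 t = (pderiv k)^[m] g t := by
  induction m generalizing t with
  | zero => exact h t
  | succ m ih =>
    rw [Function.iterate_succ_apply', Function.iterate_succ_apply']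
    exact partialDeriv_apply hΩ k ih t

lemma nsmul_succ_injective (n : ℕ) {f g : SmoothFunctions Ω A}
    (h : (n + 1) • f = (n + 1) • g) : f = g := by
  ext t
  have h1 : (n + 1) • f.1 t = (n + 1) • g.1 t := congrFun (congrArg Subtype.val h) t
  rw [← Nat.cast_smul_eq_nsmul ℝ, ← Nat.cast_smul_eq_nsmul ℝ] at h1
  exact smul_right_injective A (by positivity : ((n + 1 : ℕ) : ℝ) ≠ 0) h1

/-- The operators `f ↦ [z^{-n}] G(z)[f]`. -/
noncomputable def shiftOp (hΩ : IsTimeDomain Ω) (n : ℕ) (f : SmoothFunctions Ω A) :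
    SmoothFunctions Ω A :=
  restrict (shiftCoeff n f.extend) (f.smooth_extend.shiftCoeff hΩ n)

lemma shiftOp_apply (hΩ : IsTimeDomain Ω) (n : ℕ) {f : SmoothFunctions Ω A} {g : Times → A}
    (h : ∀ t : Ω, f.1 t = g t) (t : Ω) : (shiftOp hΩ n f).1 t = shiftCoeff n g t :=
  shiftCoeff_congr hΩ (extend_eqOn h) n t.2

lemma val_sum {ι : Type*} (s : Finset ι) (f : ι → SmoothFunctions Ω A) (t : Ω) :
    (∑ i ∈ s, f i).1 t = ∑ i ∈ s, (f i).1 t := by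
  exact (congrFun (AddSubmonoidClass.coe_finsetSum (S := smoothSubring Ω A) f s) t).trans
    (Finset.sum_apply _ _ _)

lemma shiftOp_succ (hΩ : IsTimeDomain Ω) (n : ℕ) (f : SmoothFunctions Ω A) :
    (n + 1) • shiftOp hΩ (n + 1) f =
      -∑ p ∈ antidiagonal n, shiftOp hΩ p.2 (partialDeriv A hΩ p.1.succPNat f) := by
  ext t
  have h1 := shiftCoeff_succ hΩ f.smooth_extend t.2 n
  change (n + 1) • shiftCoeff (n + 1) f.extend t = -(∑ p ∈ antidiagonal n,
    shiftOp hΩ p.2 (partialDeriv A hΩ p.1.succPNat f)).1 t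
  rw [← Nat.cast_smul_eq_nsmul ℝ, Nat.cast_succ, h1, val_sum]
  congr 1
  refine Finset.sum_congr rfl fun p _ => ?_
  exact (shiftOp_apply hΩ p.2
    (partialDeriv_apply hΩ _ fun s => (f.extend_apply s).symm) t).symm

/-- Induction on the recursion reduces this to the symmetry of mixed partial derivatives. It turns
the recursion for `shiftOp` into the hypothesis `hg` of `PDO.res_pow_eq`. -/
lemma partialDeriv_shiftOp (hΩ : IsTimeDomain Ω) (k : ℕ+) (n : ℕ) :
    ∀ f : SmoothFunctions Ω A,
      partialDeriv A hΩ k (shiftOp hΩ n f) = shiftOp hΩ n (partialDeriv A hΩ k f) := by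
  induction n using Nat.strong_induction_on with
  | _ n ih =>
    intro f
    cases n with
    | zero =>
      have h : ∀ f : SmoothFunctions Ω A, shiftOp hΩ 0 f = f := fun f => by
        ext t
        rw [shiftOp_apply hΩ 0 (fun s => (f.extend_apply s).symm), shiftCoeff_zero, extend_apply]
      rw [h, h]
    | succ n =>
      apply nsmul_succ_injective n
      rw [← map_nsmul, shiftOp_succ, shiftOp_succ, map_neg, map_sum]
      congr 1
      refine Finset.sum_congr rfl fun p hp => ?_
      rw [mem_antidiagonal] at hp
      rw [ih p.2 (by omega), partialDeriv_comm]

end SmoothFunctions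

open SmoothFunctions

/-- The operator `P` over the smooth functions on `Ω` is the restriction of `P'` to `Ω`. -/
def Represents {δ : Derivation ℤ (SmoothFunctions Ω A) (SmoothFunctions Ω A)} (P : PDO δ)
    (P' : PsiDO A) : Prop :=
  ∀ (i : ℤ) (t : Ω), (P.coeff i).1 t = P'.coeff i t

/-! ### Transfer from operators with globally defined coefficients to the ring `PDO`, and the
conclusion. -/

section Represents

variable {δ : Derivation ℤ (SmoothFunctions Ω A) (SmoothFunctions Ω A)}

lemma exists_represents (δ : Derivation ℤ (SmoothFunctions Ω A) (SmoothFunctions Ω A))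
    {P' : PsiDO A} (h : P'.Smooth Ω) : ∃ P : PDO δ, Represents P P' := by
  refine ⟨⟨fun i => restrict (P'.coeff i) (h i), ?_⟩, fun i t => rfl⟩
  obtain ⟨m, hm⟩ := P'.bounded
  refine ⟨m, fun i hi => ?_⟩
  ext t
  simp [restrict_apply, hm i hi]

lemma Represents.eq {P Q : PDO δ} {P' Q' : PsiDO A} (hP : Represents P P') (hQ : Represents Q Q')
    (h : PsiDO.EqOn Ω P' Q') : P = Q := by
  ext i t
  rw [hP, hQ]
  exact h i t.2

lemma represents_one : Represents (1 : PDO δ) PsiDO.one := by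
  intro i t
  rw [PDO.coeff_one]
  simp only [PsiDO.one]
  split_ifs <;> rfl

lemma represents_d : Represents (PDO.d δ) PsiDO.D := by
  intro i t
  rw [PDO.coeff_d]
  simp only [PsiDO.D]
  split_ifs <;> rfl

lemma Represents.plus {P : PDO δ} {P' : PsiDO A} (hP : Represents P P') :
    Represents P.plus P'.plus := by
  intro i t
  rw [PDO.coeff_plus]
  simp only [PsiDO.plus]
  split_ifs
  · exact hP i t
  · rfl

variable {hΩ : IsTimeDomain Ω}

lemma Represents.mul {P Q : PDO (partialDeriv A hΩ 1)} {P' Q' : PsiDO A} (hP : Represents P P')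
    (hQ : Represents Q Q') : Represents (P * Q) (P'.comp Q') := by
  intro n t
  obtain ⟨m, hm⟩ := P.exists_orderLE
  obtain ⟨m', hm'⟩ := Q.exists_orderLE
  have h1 : ∀ p : ℤ × ℕ, (Ring.choose p.1 p.2 : ℤ) •
      (P'.coeff p.1 t * (pderiv 1)^[p.2] (Q'.coeff (n - p.1 + p.2)) t) =
      (P.coeff p.1 * ((Ring.choose p.1 p.2 : ℤ) •
        (partialDeriv A hΩ 1)^[p.2] (Q.coeff (n - p.1 + p.2)))).1 t := by
    intro p
    rw [mul_smul_comm]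
    change _ = (Ring.choose p.1 p.2 : ℤ) • ((P.coeff p.1).1 t *
      ((partialDeriv A hΩ 1)^[p.2] (Q.coeff (n - p.1 + p.2))).1 t)
    rw [hP, iterate_partialDeriv_apply hΩ 1 (hQ _)]
  change _ = ∑ᶠ p : ℤ × ℕ, (Ring.choose p.1 p.2 : ℤ) •
      (P'.coeff p.1 t * (pderiv 1)^[p.2] (Q'.coeff (n - p.1 + p.2)) t)
  rw [finsum_congr h1]
  set K : ℕ := (m + m' - n).toNat + 1 with hK
  -- The box contains every nonzero term: `i > m` kills `P_i`, while `i < n - m'` or `k ≥ K` pushes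
  -- the index of `Q` above its order.
  rw [finsum_eq_sum_of_support_subset (s := Finset.Icc (n - m') m ×ˢ Finset.range K) _ ?_,
    ← val_sum, PDO.coeff_mul_eq_sum hm hm' n le_rfl le_rfl, Finset.sum_product]
  · refine congrArg (fun f : SmoothFunctions Ω A => f.1 t) (Finset.sum_congr rfl fun i hi => ?_)
    rw [Finset.mem_Icc] at hi
    rw [PDO.coeff_left, PDO.leftCoeff_eq_sum hm' i n (K := K) (by omega), Finset.mul_sum]
  · intro p hp
    by_contra hmem
    refine hp ?_
    simp only [Finset.coe_product, Finset.coe_Icc, Finset.coe_range, Set.mem_prod, Set.mem_Icc,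
      Set.mem_Iio] at hmem
    by_cases h2 : m < p.1
    · simp only [hm _ h2, zero_mul]
      rfl
    · simp only [hm' (n - p.1 + p.2) (by omega), iterate_map_zero, smul_zero, mul_zero]
      rfl

lemma Represents.pow {P : PDO (partialDeriv A hΩ 1)} {P' : PsiDO A} (hP : Represents P P')
    (r : ℕ) : Represents (P ^ r) (P'.pow r) := by
  induction r with
  | zero =>
    rw [pow_zero]
    exact represents_one
  | succ r ih =>
    rw [pow_succ]
    exact ih.mul hP

end Represents

lemma lax_smooth {U : ℕ+ → Times → A} (hU : ∀ k, SmoothOn Ω (U k)) : (lax U).Smooth Ω := by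
  intro i
  simp only [lax]
  split_ifs
  · exact SmoothOn.const 1
  · exact hU _
  · exact SmoothOn.const 0

lemma dressing_smooth {W : ℕ → Times → A} (hW : ∀ k, SmoothOn Ω (W k)) :
    (dressing W).Smooth Ω := by
  intro i
  simp only [dressing]
  split_ifs
  · exact hW _
  · exact SmoothOn.const 0

/-- `res L^i = ∂_i (τ_x / τ)`. -/
theorem res_pow_lax {A : Type*} [NormedCommRing A] [NormedAlgebra ℝ A] [CompleteSpace A]
    {Ω : Set Times} (hΩ : IsTimeDomain Ω) {U : ℕ+ → Times → A} (hU : ∀ k, SmoothOn Ω (U k))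
    (hKP : IsKPSolution Ω (lax U)) {W : ℕ → Times → A} (hW : ∀ k, SmoothOn Ω (W k))
    (hW0 : ∀ t ∈ Ω, W 0 t = 1) (hΦ : IsDressing Ω (lax U) (dressing W)) {τ : Times → A}
    (hτ : IsTauFunction Ω W τ) (i : ℕ+) {t : Times} (ht : t ∈ Ω) :
    ((lax U).pow i).res t = pderiv i (fun s => pderiv 1 τ s * Ring.inverse (τ s)) t := by
  obtain ⟨Ψ', hΨ', hΦΨ, hΨΦ, hLax⟩ := hΦ
  obtain ⟨hτs, hτu, hτW⟩ := hτ
  let D : ℕ → Derivation ℤ (SmoothFunctions Ω A) (SmoothFunctions Ω A) :=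
    fun r => partialDeriv A hΩ r.succPNat
  obtain ⟨L, hL⟩ := exists_represents (D 0) (lax_smooth hU)
  obtain ⟨Φ, hΦ⟩ := exists_represents (D 0) (dressing_smooth hW)
  obtain ⟨Ψ, hΨ⟩ := exists_represents (D 0) hΨ'
  have hinv : ∀ t ∈ Ω, τ t * Ring.inverse (τ t) = 1 := fun t ht => Ring.mul_inverse_cancel _ (hτu t ht)
  set T := restrict τ hτs with hT
  set T' := restrict _ (hτs.ringInverse hτu) with hT'
  have hTT' : T * T' = 1 := by
    ext t
    exact hinv t t.2
  have hΦorder : Φ.OrderLE 0 := by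
    intro i hi
    ext t
    rw [hΦ]
    simp [dressing, hi.not_ge]
  have hΦ0 : Φ.coeff 0 = 1 := by
    ext t
    rw [hΦ]
    simpa [dressing] using hW0 t t.2
  have hKP' : ∀ r, L.map (D r) = (L ^ (r + 1)).plus * L - L * (L ^ (r + 1)).plus := by
    intro r
    ext i t
    have h1 : Represents (L ^ (r + 1)).plus ((lax U).pow r.succPNat).plus :=
      (Represents.pow hL (r + 1)).plus
    rw [PDO.coeff_map, PDO.coeff_sub]
    refine (partialDeriv_apply hΩ _ (hL i) t).trans ((hKP r.succPNat i t t.2).trans ?_)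
    rw [← Represents.mul h1 hL i t, ← Represents.mul hL h1 i t]
    rfl
  have hg : ∀ n : ℕ, ((n : SmoothFunctions Ω A) + 1) * shiftOp hΩ (n + 1) T =
      -∑ p ∈ antidiagonal n, D p.1 (shiftOp hΩ p.2 T) := by
    intro n
    have h1 := shiftOp_succ hΩ n T
    rw [nsmul_eq_mul, Nat.cast_succ] at h1
    rw [h1]
    congr 1
    exact Finset.sum_congr rfl fun p _ => (partialDeriv_shiftOp hΩ _ _ _).symm
  have hgW : ∀ n : ℕ, Φ.coeff (-(n : ℤ)) * T = shiftOp hΩ n T := by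
    intro n
    ext t
    rw [shiftOp_apply hΩ n (fun s => restrict_apply τ hτs s) t]
    change (Φ.coeff (-(n : ℤ))).1 t * τ t = _
    rw [hΦ]
    have h1 : (dressing W).coeff (-(n : ℤ)) t = W n t := by simp [dressing]
    rw [h1, hτW n t t.2, mul_assoc, mul_comm (Ring.inverse _), hinv t t.2, mul_one]
  have main := PDO.res_pow_eq D (fun i j => partialDeriv_comm hΩ _ _) hΦorder hΦ0
    ((Represents.mul hΨ hΦ).eq represents_one hΨΦ) ((Represents.mul hΦ hΨ).eq represents_one hΦΨ)
    (hL.eq (Represents.mul (Represents.mul hΦ represents_d) hΨ) hLax) hKP' hTT' _ hg hgW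
  -- The times are numbered from 1 and the derivations `D r` from 0.
  obtain ⟨r, rfl⟩ : ∃ r : ℕ, i = r.succPNat := ⟨i.natPred, (PNat.succPNat_natPred i).symm⟩
  have h1 := congrFun (congrArg Subtype.val (main r)) ⟨t, ht⟩
  have h2 : ∀ s : Ω, (D 0 T * T').1 s = pderiv 1 τ s * Ring.inverse (τ s) := by
    intro s
    change (partialDeriv A hΩ 1 T).1 s * Ring.inverse (τ s) = _
    rw [partialDeriv_apply hΩ 1 (fun s => restrict_apply τ hτs s)]
  rw [partialDeriv_apply hΩ r.succPNat
    (g := fun s => pderiv 1 τ s * Ring.inverse (τ s)) h2 ⟨t, ht⟩] at h1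
  rw [← h1]
  exact ((Represents.pow hL (r + 1)) (-1) ⟨t, ht⟩).symm

end AKP

theorem mainTheorem2 {A : Type*} [NormedCommRing A] [NormedAlgebra ℝ A] [FiniteDimensional ℝ A]
    (φ : Module.Dual ℝ A) (hφ : AKP.IsFrobeniusForm φ)
    (Ω : Set AKP.Times) (hΩ : AKP.IsTimeDomain Ω)
    (U : ℕ+ → AKP.Times → A) (hU : ∀ k, AKP.SmoothOn Ω (U k))
    (hKP : AKP.IsKPSolution Ω (AKP.lax U))
    (W : ℕ → AKP.Times → A) (hW : ∀ k, AKP.SmoothOn Ω (W k)) (hW0 : ∀ t ∈ Ω, W 0 t = 1)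
    (hΦ : AKP.IsDressing Ω (AKP.lax U) (AKP.dressing W))
    (τ : AKP.Times → A) (hτ : AKP.IsTauFunction Ω W τ) :
    ∀ i : ℕ+, ∀ t ∈ Ω,
      ((AKP.lax U).pow i).res t =
        AKP.pderiv i (fun s => AKP.pderiv 1 τ s * Ring.inverse (τ s)) t := by
  -- Completeness makes inversion smooth at units, hence `τ⁻¹` smooth on `Ω`.
  have : CompleteSpace A := FiniteDimensional.complete ℝ A
  exact fun i t ht => AKP.res_pow_lax hΩ hU hKP hW hW0 hΦ hτ i ht
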